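/- **Notation.** $(x)_n=x(x+1)\cdots(x+n-1)$, $(x)_0=1$. For $b_0,\dots,b_d\ge 0$ not all zero let $T=\{i: b_i>0\}$; the Dirichlet distribution $\mathcal D(b_0,\dots,b_d)$ on $\mathbb R^{d+1}$ is the law of the vector whose coordinates outside $T$ vanish and whose coordinates in $T$ are positive, sum to $1$, and are such that, for $i_0=\min T$, the coordinates $(x_i)_{i\in T\setminus\{i_0\}}$ have density $$\frac{\Gamma(\sum_{i\in T}b_i)}{\prod_{i\in T}\Gamma(b_i)}\prod_{i\in T}x_i^{b_i-1},\qquad x_{i_0}=1-\sum_{i\in T\setminus\{i_0\}}x_i,$$ on the set where $x_i>0$ for all $i\in T$ (it is a point mass $\delta_{e_{i_0}}$ if $T=\{i_0\}$). For a positive integer $k$ and $a_0,\dots,a_d\ge 0$ with $a=a_0+\cdots+a_d>0$, the quasi Bernoulli distribution of order $k$ is $$\mathcal B_k(a_0,\dots,a_d)=\frac{k!}{(a)_k}\sum_{\substack{(b_0,\dots,b_d)\in\mathbb N^{d+1}\\ b_0+\cdots+b_d=k}}\ \prod_{i=0}^d\frac{(a_i)_{b_i}}{b_i!}\ \mathcal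 D(b_0,\dots,b_d).$$ **Theorem 5.1.** Let $\alpha$ be a measure on a measurable space $\Omega$ with $0<a=\alpha(\Omega)<\infty$, and let $k$ be a positive integer. Then there exist, on some probability space, random variables $(M,X,W)$ such that: 1. $M=(M_1,\dots,M_k)\in\mathbb N^k$ satisfies $M_1+2M_2+\cdots+kM_k=k$ almost surely and has the Ewens distribution with parameters $k$ and $a$: for all $m\in\mathbb N^k$ with $m_1+2m_2+\cdots+km_k=k$, $$\Pr(M=m)=\frac{k!}{\prod_{j=1}^k j^{m_j}m_j!}\cdot\frac{a^{m_1+\cdots+m_k}}{(a)_k}.$$ Write $S_j=M_1+\cdots+M_j$ (so $S_0=0$) and $B(M)=(b_t)_{t=1}^{S_k}$, where $b_t=j$ for $S_{j-1}<t\le S_j$. 2. Conditionally on $M$, the variables $X=(X_t)_{t=1}^{S_k}$ are i.i.d. in $\Omega$ with law $\alpha/a$. 3. Conditionally on $M$, $W=(W_t)_{t=1}^{S_k}\sim\mathcal D(B(M))$. 4. Conditionally on $M$, $X$ and $W$ are independent. Moreover, for any random variables $(M,X,W)$ on any probability space satisfying 1–4, $P=\sum_{t=1}^{S_k}W_t\,\delta_{X_t}$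 (where negative weights, which occur with probability $0$, are replaced by $0$) is a random probability on $\Omega$ (a measurable random measure that is almost surely a probability measure), and it is a quasi Bernoulli process: for every $d\ge 0$ and every partition $(A_0,\dots,A_d)$ of $\Omega$ into measurable sets (some possibly empty), $$(P(A_0),\dots,P(A_d))\sim\mathcal B_k(\alpha(A_0),\dots,\alpha(A_d)).$$ -/

import Mathlib

open MeasureTheory ProbabilityTheory
open scoped BigOperators ENNReal Nat

universe u v

namespace QuasiBernoulli

noncomputable section

/-- The point of `ℝ^ι` whose coordinates in the support `T = {i | 0 < a i}`, apart from the
distinguished index `i₀ ∈ T`, are given by `x`, whose coordinate `i₀` makes the coordinates sum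
to one, and whose coordinates outside `T` vanish. -/
def simplexPoint {ι : Type*} [Fintype ι] (a : ι → ℝ) (i₀ : ι)
    (x : {i : ι // 0 < a i ∧ i ≠ i₀} → ℝ) (i : ι) : ℝ :=
  open Classical in
  if h : 0 < a i ∧ i ≠ i₀ then x ⟨i, h⟩ else if i = i₀ then 1 - ∑ j, x j else 0

/-- The Dirichlet density in the free coordinates `x_i`, `i ∈ T \ {i₀}`, with
`x_{i₀} = 1 - ∑ x_i`:
`Γ(∑_{i ∈ T} a_i) / ∏_{i ∈ T} Γ(a_i) * ∏_{i ∈ T} x_i ^ (a_i - 1)` where all `x_i > 0`, `i ∈ T`,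
and zero elsewhere. -/
def dirichletDensity {ι : Type*} [Fintype ι] (a : ι → ℝ) (i₀ : ι)
    (x : {i : ι // 0 < a i ∧ i ≠ i₀} → ℝ) : ℝ≥0∞ :=
  open Classical in
  if ∀ i, 0 < a i → 0 < simplexPoint a i₀ x i then
    ENNReal.ofReal
      (Real.Gamma (∑ i with 0 < a i, a i) / (∏ i with 0 < a i, Real.Gamma (a i)) *
        ∏ i with 0 < a i, simplexPoint a i₀ x i ^ (a i - 1))
  else 0

/-- The Dirichlet distribution `D(a_0, …, a_{n-1})` on the simplex of `ℝ^n`, for parameters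
`a_i ≥ 0` not all zero. It is carried by the face spanned by the `e_i` with `a_i > 0`; the free
coordinates on that face are all but the first one. (Junk value `0` if no `a_i` is positive.) -/
def dirichlet {n : ℕ} (a : Fin n → ℝ) : Measure (Fin n → ℝ) :=
  open Classical in
  if h : (Finset.univ.filter fun i => 0 < a i).Nonempty then
    let i₀ : Fin n := (Finset.univ.filter fun i => 0 < a i).min' h
    ((volume : Measure ({i : Fin n // 0 < a i ∧ i ≠ i₀} → ℝ)).withDensity
      (dirichletDensity a i₀)).map (simplexPoint a i₀)
  else 0

/-- The Pochhammer symbol `(x)_n = x (x + 1) ⋯ (x + n - 1)`. -/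
def poch (x : ℝ) (n : ℕ) : ℝ := (ascPochhammer ℝ n).eval x

/-- The quasi Bernoulli distribution `B_k(a_0, …, a_d)` of order `k`, for `a_i ≥ 0` not all zero:
the mixture of the Dirichlet distributions `D(b_0, …, b_d)`, `b ∈ ℕ^{d+1}`, `∑ b_i = k`, with
weights `k! / (a)_k * ∏ (a_i)_{b_i} / b_i!`, where `a = ∑ a_i`. -/
def quasiBernoulli (k : ℕ) {n : ℕ} (a : Fin n → ℝ) : Measure (Fin n → ℝ) :=
  ∑ b ∈ Finset.piAntidiag (Finset.univ : Finset (Fin n)) k,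
    ENNReal.ofReal ((k ! : ℝ) / poch (∑ i, a i) k * ∏ i, poch (a i) (b i) / ((b i)! : ℝ)) •
      dirichlet fun i => (b i : ℝ)

/-- `C(m) = k! / ∏_j j^{m_j} m_j!`. The entry `m j`, `j : Fin k`, stands for `m_{j+1}`. -/
def ewensCoeff {k : ℕ} (m : Fin k → ℕ) : ℝ :=
  (k ! : ℝ) / ∏ j : Fin k, ((j : ℝ) + 1) ^ m j * ((m j)! : ℝ)

/-- The Ewens distribution with parameters `k` and `a` on the `m ∈ ℕ^k` with
`m_1 + 2 m_2 + ⋯ + k m_k = k`. -/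
def ewens (k : ℕ) (a : ℝ) : Measure (Fin k → ℕ) :=
  Measure.sum fun m : {m : Fin k → ℕ // ∑ j : Fin k, ((j : ℕ) + 1) * m j = k} =>
    ENNReal.ofReal (ewensCoeff m.1 * a ^ (∑ j, m.1 j) / poch a k) • Measure.dirac m.1

/-- `S_j = m_1 + ⋯ + m_j`. -/
def partialSum {k : ℕ} (m : Fin k → ℕ) (j : ℕ) : ℕ :=
  ∑ i ∈ Finset.univ.filter (fun i : Fin k => (i : ℕ) < j), m i

/-- The number `S_k = m_1 + ⋯ + m_k` of parts of the partition coded by `m`. -/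
def numParts {k : ℕ} (m : Fin k → ℕ) : ℕ := partialSum m k

/-- The parts in increasing order: indices start at `0`, so `part m t` is `b_{t+1}`, namely the
`j` with `S_{j-1} < t + 1 ≤ S_j`, i.e. the least `j` with `t < S_j` (for `t < S_k`). -/
def part {k : ℕ} (m : Fin k → ℕ) (t : ℕ) : ℕ := sInf {j : ℕ | t < partialSum m j}

/-- The random variables `(M, X, W)`, on a probability space `(Θ, μ)`. Only the `X_t` and
`W_t` with `t < S_k(M)` are constrained (indices `t` start at `0`). The law of `(X, W)` given `M`
is specified on each event `{M = m}` of positive probability. -/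
structure IsEwensSelection {Ω Θ : Type*} [MeasurableSpace Ω] [MeasurableSpace Θ]
    (k : ℕ) (α : Measure Ω) (μ : Measure Θ)
    (M : Θ → Fin k → ℕ) (X : ℕ → Θ → Ω) (W : ℕ → Θ → ℝ) : Prop where
  measurable_M : Measurable M
  measurable_X : ∀ t, Measurable (X t)
  measurable_W : ∀ t, Measurable (W t)
  /-- `M` has the Ewens distribution with parameters `k` and `a = α(Ω)`. -/
  law_M : HasLaw M (ewens k (α.real Set.univ)) μ
  /-- Given `M`, each `X_t` has law `α / a`. -/
  law_X : ∀ m, μ (M ⁻¹' {m}) ≠ 0 → ∀ t < numParts m,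
    HasLaw (X t) ((α Set.univ)⁻¹ • α) (cond μ (M ⁻¹' {m}))
  /-- Given `M`, the `X_t` are independent. -/
  indep_X : ∀ m, μ (M ⁻¹' {m}) ≠ 0 →
    iIndepFun (fun t : Fin (numParts m) => X t) (cond μ (M ⁻¹' {m}))
  /-- Given `M`, the vector `W` has law `D(B(M))`. -/
  law_W : ∀ m, μ (M ⁻¹' {m}) ≠ 0 →
    HasLaw (fun θ (t : Fin (numParts m)) => W t θ)
      (dirichlet fun t : Fin (numParts m) => (part m t : ℝ)) (cond μ (M ⁻¹' {m}))
  /-- Given `M`, the vectors `X` and `W` are independent. -/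
  indep_X_W : ∀ m, μ (M ⁻¹' {m}) ≠ 0 →
    IndepFun (fun θ (t : Fin (numParts m)) => X t θ) (fun θ (t : Fin (numParts m)) => W t θ)
      (cond μ (M ⁻¹' {m}))

/-- The random measure `P = ∑_t W_t δ_{X_t}`, the sum being over the `S_k(M)` parts. -/
def randomMeasure {Ω Θ : Type*} [MeasurableSpace Ω] {k : ℕ}
    (M : Θ → Fin k → ℕ) (X : ℕ → Θ → Ω) (W : ℕ → Θ → ℝ) (θ : Θ) : Measure Ω :=
  ∑ t ∈ Finset.range (numParts (M θ)), ENNReal.ofReal (W t θ) • Measure.dirac (X t θ)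

/-- `P` is a quasi Bernoulli process `B_k(α)`: a random probability such that
`(P(A_0), …, P(A_d)) ~ B_k(α(A_0), …, α(A_d))` for every finite measurable partition. -/
structure IsQuasiBernoulliProcess {Ω Θ : Type*} [MeasurableSpace Ω] [MeasurableSpace Θ]
    (k : ℕ) (α : Measure Ω) (μ : Measure Θ) (P : Θ → Measure Ω) : Prop where
  measurable : Measurable P
  isProbabilityMeasure : ∀ᵐ θ ∂μ, IsProbabilityMeasure (P θ)
  law : ∀ (d : ℕ) (A : Fin (d + 1) → Set Ω), (∀ i, MeasurableSet (A i)) →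
    Pairwise (fun i j => Disjoint (A i) (A j)) → ⋃ i, A i = Set.univ →
    HasLaw (fun θ i => (P θ).real (A i)) (quasiBernoulli k fun i => α.real (A i)) μ

end

end QuasiBernoulli

/-!
Colour the `t`-th part of the Ewens partition by the cell of `(A_0, …, A_d)` containing `X_t`: the
vector `(P(A_0), …, P(A_d))` collects the weights of each colour. Being a normalized vector of
independent gamma variables, a Dirichlet vector stays Dirichlet when its coordinates are grouped and
summed, so given `M` and the colours the law is `D(b)`, with `b_i` the total size of the parts of
colour `i`. It remains to see that, for a random partition of `k` with colours, `b` has the weights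
of `B_k`. Conditionally on `M` its law has generating function `∏_j (∑_i (a_i / a) x_i^j)^{M_j}`, so
this is the cycle index identity
`∑_m ∏_j p_j^{m_j} / (j^{m_j} m_j!) = ∑_b ∏_i (a_i)_{b_i} / b_i! x_i^{b_i}`, `p_j = ∑_i a_i x_i^j`,
whose two sides satisfy the same Newton recursion `k h_k = ∑_{j=1}^k p_j h_{k-j}`.
-/

namespace QuasiBernoulli

section CycleIndex

open Finset

theorem sum_eq_sum_add_single {ι M : Type*} [DecidableEq ι] [AddCommMonoid M]
    {s s' : Finset (ι → ℕ)} {i : ι} {c : ℕ} {f : (ι → ℕ) → M}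
    (hs : ∀ m, m + Pi.single i c ∈ s ↔ m ∈ s') (hf : ∀ m ∈ s, m i < c → f m = 0) :
    ∑ m ∈ s, f m = ∑ m ∈ s', f (m + Pi.single i c) := by
  symm
  refine sum_of_injOn (· + Pi.single i c) (add_left_injective _).injOn
    (fun m hm => (hs m).2 hm) (fun m hm hnot => hf m hm (not_le.1 fun hc => hnot ?_))
    fun _ _ => rfl
  have hm' : m - Pi.single i c + Pi.single i c = m := by
    refine tsub_add_cancel_of_le fun l => ?_
    obtain rfl | hl := eq_or_ne l i
    · simpa using hc
    · simp [hl]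
  exact ⟨m - Pi.single i c, mem_coe.2 ((hs _).1 (hm'.symm ▸ hm)), hm'⟩

theorem prod_apply_update {ι α R : Type*} [Fintype ι] [DecidableEq ι] [CommMonoid R]
    (F : ι → α → R) (b : ι → α) (i : ι) (c : α) :
    ∏ l, F l (Function.update b i c l) = F i c * ∏ l ∈ univ \ {i}, F l (b l) := by
  simp_rw [Function.apply_update]
  exact prod_update_of_mem (mem_univ i) _ _

/-- The integer `m_1 + 2 m_2 + ⋯ + K m_K` partitioned by `m`, the entry `m j` counting the parts
of size `j + 1`. -/
def weight {K : ℕ} (m : Fin K → ℕ) : ℕ := ∑ j : Fin K, ((j : ℕ) + 1) * m j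

theorem mul_le_weight {K : ℕ} (m : Fin K → ℕ) (j : Fin K) : ((j : ℕ) + 1) * m j ≤ weight m :=
  single_le_sum (f := fun j : Fin K => ((j : ℕ) + 1) * m j) (fun _ _ => Nat.zero_le _) (mem_univ j)

theorem le_weight {K : ℕ} (m : Fin K → ℕ) (j : Fin K) : m j ≤ weight m :=
  (Nat.le_mul_of_pos_left _ (Nat.succ_pos _)).trans (mul_le_weight m j)

theorem weight_add_single {K : ℕ} (m : Fin K → ℕ) (j : Fin K) :
    weight (m + Pi.single j 1) = weight m + (j + 1) := by
  simp [weight, mul_add, sum_add_distrib, Pi.single_apply]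

/-- The partitions of `n` with parts of size at most `K`. -/
def ofWeight (K n : ℕ) : Finset (Fin K → ℕ) :=
  {m ∈ Fintype.piFinset fun _ => range (n + 1) | weight m = n}

@[simp]
theorem mem_ofWeight {K n : ℕ} {m : Fin K → ℕ} : m ∈ ofWeight K n ↔ weight m = n := by
  simp only [ofWeight, mem_filter, Fintype.mem_piFinset, mem_range, and_iff_right_iff_imp]
  rintro rfl j
  exact Nat.lt_succ_of_le (le_weight m j)

theorem ofWeight_zero (K : ℕ) : ofWeight K 0 = {0} := by
  ext m
  simp [weight, funext_iff]

section Newton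

variable {R : Type*} [CommSemiring R] [Algebra ℝ R]

theorem eq_of_newton_recursion {p u v : ℕ → R} {K : ℕ} (h0 : u 0 = v 0)
    (hu : ∀ n < K, ((n + 1 : ℕ) : ℝ) • u (n + 1) = ∑ j ∈ range (n + 1), p (j + 1) * u (n - j))
    (hv : ∀ n < K, ((n + 1 : ℕ) : ℝ) • v (n + 1) = ∑ j ∈ range (n + 1), p (j + 1) * v (n - j))
    {n : ℕ} (hn : n ≤ K) : u n = v n := by
  induction n using Nat.strong_induction_on with
  | _ n ih =>
    cases n with
    | zero => exact h0
    | succ n =>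
      have hne : ((n + 1 : ℕ) : ℝ) ≠ 0 := by positivity
      refine hne.isUnit.smul_left_cancel.1 ?_
      rw [hu n hn, hv n hn]
      exact sum_congr rfl fun j _ => by rw [ih (n - j) (by lia) (by lia)]

/-- The term `∏_j (p_j / j)^{m_j} / m_j!` of the cycle index of the symmetric group. -/
noncomputable def cycleMonomial {K : ℕ} (p : ℕ → R) (m : Fin K → ℕ) : R :=
  ∏ j : Fin K, (((j : ℝ) + 1) ^ m j * ((m j)! : ℝ))⁻¹ • p (j + 1) ^ m j

theorem cycleMonomial_add_single {K : ℕ} (p : ℕ → R) (m : Fin K → ℕ) (j : Fin K) :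
    (((j : ℝ) + 1) * ((m j + 1 : ℕ) : ℝ)) • cycleMonomial p (m + Pi.single j 1) =
      p (j + 1) * cycleMonomial p m := by
  let F : Fin K → ℕ → R := fun i n => (((i : ℝ) + 1) ^ n * (n ! : ℝ))⁻¹ • p (i + 1) ^ n
  have hF : (((j : ℝ) + 1) * ((m j + 1 : ℕ) : ℝ)) • F j (m j + 1) = p (j + 1) * F j (m j) := by
    simp only [F, smul_smul, Nat.factorial_succ, mul_smul_comm, pow_succ' (p _)]
    congr 1
    have : (j : ℝ) + 1 ≠ 0 := by positivity
    push_cast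
    field_simp
    ring
  have hupdate : m + Pi.single j 1 = Function.update m j (m j + 1) := by
    ext i
    by_cases h : i = j <;> simp_all
  have hm := prod_apply_update F m j (m j)
  rw [Function.update_eq_self] at hm
  rw [hupdate, cycleMonomial, prod_apply_update F, cycleMonomial, hm, ← smul_mul_assoc, hF,
    mul_assoc]

theorem sum_mul_cycleMonomial {K n : ℕ} (p : ℕ → R) {j : Fin K} (hj : (j : ℕ) ≤ n) :
    ∑ m ∈ ofWeight K (n + 1), (((j : ℝ) + 1) * (m j : ℝ)) • cycleMonomial p m =
      p (j + 1) * ∑ m ∈ ofWeight K (n - j), cycleMonomial p m := by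
  rw [mul_sum, sum_eq_sum_add_single (i := j) (c := 1) (s' := ofWeight K (n - j))]
  · refine sum_congr rfl fun m _ => ?_
    rw [← cycleMonomial_add_single, Pi.add_apply, Pi.single_eq_same]
  · intro m
    rw [mem_ofWeight, mem_ofWeight, weight_add_single]
    lia
  · intro m _ hm
    simp [Nat.lt_one_iff.1 hm]

theorem sum_cycleMonomial_recursion {K n : ℕ} (p : ℕ → R) (hn : n < K) :
    ((n + 1 : ℕ) : ℝ) • ∑ m ∈ ofWeight K (n + 1), cycleMonomial p m =
      ∑ j ∈ range (n + 1), p (j + 1) * ∑ m ∈ ofWeight K (n - j), cycleMonomial p m := by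
  have hlarge : ∀ j : Fin K, n < j → ∀ m ∈ ofWeight K (n + 1),
      (((j : ℝ) + 1) * (m j : ℝ)) • cycleMonomial p m = 0 := by
    intro j hj m hm
    have hle := mul_le_weight m j
    rw [mem_ofWeight.1 hm] at hle
    have : m j = 0 := by
      by_contra h
      nlinarith [Nat.pos_of_ne_zero h]
    simp [this]
  calc ((n + 1 : ℕ) : ℝ) • ∑ m ∈ ofWeight K (n + 1), cycleMonomial p m
      = ∑ j : Fin K, ∑ m ∈ ofWeight K (n + 1),
          (((j : ℝ) + 1) * (m j : ℝ)) • cycleMonomial p m := by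
        rw [sum_comm, smul_sum]
        refine sum_congr rfl fun m hm => ?_
        rw [← sum_smul, ← mem_ofWeight.1 hm, weight]
        push_cast
        rfl
    _ = ∑ j : Fin K, if (j : ℕ) < n + 1 then
          p (j + 1) * ∑ m ∈ ofWeight K (n - j), cycleMonomial p m else 0 := by
        refine sum_congr rfl fun j _ => ?_
        split_ifs with hj
        · exact sum_mul_cycleMonomial p (Nat.lt_succ_iff.1 hj)
        · exact sum_eq_zero (hlarge j (by lia))
    _ = ∑ j ∈ range (n + 1), p (j + 1) * ∑ m ∈ ofWeight K (n - j), cycleMonomial p m := by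
        rw [Fin.sum_univ_eq_sum_range (fun j => if j < n + 1 then
          p (j + 1) * ∑ m ∈ ofWeight K (n - j), cycleMonomial p m else 0) K, ← sum_filter]
        congr 1
        ext j
        simp only [mem_filter, mem_range]
        lia

theorem poch_zero (x : ℝ) : poch x 0 = 1 := by simp [poch]

theorem poch_succ (x : ℝ) (n : ℕ) : poch x (n + 1) = poch x n * (x + n) := by
  simp [poch, ascPochhammer_succ_eval]

theorem poch_pos {x : ℝ} (hx : 0 < x) (n : ℕ) : 0 < poch x n := ascPochhammer_pos n x hx

theorem mul_poch_div_factorial (x : ℝ) (n : ℕ) :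
    (n : ℝ) * (poch x n / (n ! : ℝ)) =
      ∑ j ∈ range n, x * (poch x (n - 1 - j) / ((n - 1 - j)! : ℝ)) := by
  rw [sum_range_reflect (fun j => x * (poch x j / (j ! : ℝ)))]
  induction n with
  | zero => simp
  | succ n ih =>
    rw [sum_range_succ, ← ih, poch_succ, Nat.factorial_succ]
    push_cast
    field_simp
    ring

variable {ι : Type*} [Fintype ι] [DecidableEq ι]

/-- The monomial `∏_i (a_i)_{b_i} / b_i! x_i^{b_i}`, a term of the power series
`∏_i (1 - x_i)^{-a_i}`. -/
noncomputable def pochMonomial (a : ι → ℝ) (x : ι → R) (b : ι → ℕ) : R :=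
  ∏ i, (poch (a i) (b i) / ((b i)! : ℝ)) • x i ^ b i

theorem smul_pochMonomial (a : ι → ℝ) (x : ι → R) (b : ι → ℕ) (i : ι) :
    (b i : ℝ) • pochMonomial a x b = ∑ j ∈ range (b i),
      (a i • x i ^ (j + 1)) * pochMonomial a x (b - Pi.single i (j + 1)) := by
  let F : ι → ℕ → R := fun l n => (poch (a l) n / (n ! : ℝ)) • x l ^ n
  have hF : (b i : ℝ) • F i (b i) =
      ∑ j ∈ range (b i), (a i • x i ^ (j + 1)) * F i (b i - 1 - j) := by
    simp only [F]
    rw [smul_smul, mul_poch_div_factorial, sum_smul]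
    refine sum_congr rfl fun j hj => ?_
    have hj := mem_range.1 hj
    rw [smul_mul_smul_comm, ← pow_add]
    congr 2
    lia
  have hupdate : ∀ j, b - Pi.single i (j + 1) = Function.update b i (b i - 1 - j) := by
    intro j
    ext l
    by_cases h : l = i <;> simp_all
    lia
  have hprod : ∀ c, pochMonomial a x (Function.update b i c) =
      F i c * ∏ l ∈ univ \ {i}, F l (b l) := prod_apply_update F b i
  have hb := hprod (b i)
  rw [Function.update_eq_self] at hb
  simp_rw [hupdate, hprod, hb, ← mul_assoc]
  rw [← sum_mul, ← smul_mul_assoc, hF]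

theorem sum_smul_pochMonomial (a : ι → ℝ) (x : ι → R) (n : ℕ) (i : ι) :
    ∑ b ∈ piAntidiag univ (n + 1), (b i : ℝ) • pochMonomial a x b =
      ∑ j ∈ range (n + 1),
        (a i • x i ^ (j + 1)) * ∑ b ∈ piAntidiag univ (n - j), pochMonomial a x b := by
  simp_rw [smul_pochMonomial]
  rw [sum_comm' (t' := range (n + 1)) (s' := fun j => {b ∈ piAntidiag univ (n + 1) | j < b i})]
  · refine sum_congr rfl fun j hj => ?_
    have hj := mem_range.1 hj
    rw [mul_sum, sum_eq_sum_add_single (i := i) (c := j + 1) (s' := piAntidiag univ (n - j))]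
    · simp_rw [add_tsub_cancel_right]
    · intro b
      simp only [mem_filter, mem_piAntidiag, Pi.add_apply, sum_add_distrib, sum_pi_single',
        mem_univ, if_true, implies_true, and_true, Pi.single_eq_same]
      lia
    · intro b hb hlt
      have := (mem_filter.1 hb).2
      lia
  · intro b j
    simp only [mem_filter, mem_range]
    refine ⟨fun ⟨hb, hj⟩ => ⟨⟨hb, hj⟩, ?_⟩, fun ⟨h, _⟩ => h⟩
    have hle := single_le_sum (f := b) (fun _ _ => Nat.zero_le _) (mem_univ i)
    rw [(mem_piAntidiag.1 hb).1] at hle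
    lia

theorem sum_pochMonomial_recursion (a : ι → ℝ) (x : ι → R) (n : ℕ) :
    ((n + 1 : ℕ) : ℝ) • ∑ b ∈ piAntidiag univ (n + 1), pochMonomial a x b =
      ∑ j ∈ range (n + 1), (∑ i, a i • x i ^ (j + 1)) *
        ∑ b ∈ piAntidiag univ (n - j), pochMonomial a x b := by
  calc ((n + 1 : ℕ) : ℝ) • ∑ b ∈ piAntidiag univ (n + 1), pochMonomial a x b
      = ∑ i, ∑ b ∈ piAntidiag univ (n + 1), (b i : ℝ) • pochMonomial a x b := by
        rw [sum_comm, smul_sum]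
        refine sum_congr rfl fun b hb => ?_
        rw [← sum_smul, ← Nat.cast_sum, (mem_piAntidiag.1 hb).1]
    _ = _ := by
        simp_rw [sum_smul_pochMonomial, sum_mul]
        exact sum_comm

theorem sum_cycleMonomial_eq_sum_pochMonomial (a : ι → ℝ) (x : ι → R) (n : ℕ) :
    ∑ m ∈ ofWeight n n, cycleMonomial (fun j => ∑ i, a i • x i ^ j) m =
      ∑ b ∈ piAntidiag univ n, pochMonomial a x b := by
  refine eq_of_newton_recursion (p := fun j => ∑ i, a i • x i ^ j)
    (u := fun l => ∑ m ∈ ofWeight n l, cycleMonomial (fun j => ∑ i, a i • x i ^ j) m)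
    (v := fun l => ∑ b ∈ piAntidiag univ l, pochMonomial a x b)
    ?_ (fun l hl => sum_cycleMonomial_recursion _ hl)
    (fun l _ => sum_pochMonomial_recursion a x l) le_rfl
  simp [ofWeight_zero, cycleMonomial, pochMonomial, poch_zero]

end Newton

end CycleIndex

section Parts

open Finset

variable {k : ℕ} (m : Fin k → ℕ)

@[to_additive]
theorem prod_filter_val_lt_succ {R : Type*} [CommMonoid R] (j : Fin k) (g : Fin k → R) :
    ∏ i ∈ univ.filter fun i : Fin k => (i : ℕ) < j + 1, g i =
      (∏ i ∈ univ.filter fun i : Fin k => (i : ℕ) < j, g i) * g j := by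
  have h : univ.filter (fun i : Fin k => (i : ℕ) < j + 1) =
      insert j (univ.filter fun i : Fin k => (i : ℕ) < j) := by
    ext i
    simp only [mem_filter, mem_univ, true_and, mem_insert, Fin.ext_iff]
    lia
  rw [h, prod_insert (by simp), mul_comm]

theorem partialSum_succ (j : Fin k) : partialSum m (j + 1) = partialSum m j + m j :=
  sum_filter_val_lt_succ j m

theorem partialSum_mono : Monotone (partialSum m) := fun i j hij =>
  sum_le_sum_of_subset fun l hl => by
    simp only [mem_filter, mem_univ, true_and] at hl ⊢
    lia

theorem numParts_eq_sum : numParts m = ∑ j, m j := by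
  simp [numParts, partialSum]

theorem part_eq_succ {j t : ℕ} (h1 : partialSum m j ≤ t) (h2 : t < partialSum m (j + 1)) :
    part m t = j + 1 := by
  refine le_antisymm (Nat.sInf_le h2) (Nat.succ_le_of_lt (not_le.1 fun h => ?_))
  have hmem : t < partialSum m (part m t) :=
    Nat.sInf_mem (s := {j : ℕ | t < partialSum m j}) ⟨j + 1, h2⟩
  exact absurd ((partialSum_mono m h).trans h1) (not_le.2 hmem)

@[to_additive]
theorem prod_range_part {R : Type*} [CommMonoid R] (g : ℕ → R) {j : ℕ} (hj : j ≤ k) :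
    ∏ t ∈ range (partialSum m j), g (part m t) =
      ∏ i ∈ univ.filter fun i : Fin k => (i : ℕ) < j, g (i + 1) ^ m i := by
  induction j with
  | zero => simp [partialSum]
  | succ j ih =>
    have hsucc := partialSum_succ m ⟨j, hj⟩
    rw [hsucc, prod_range_add, ih (by lia), prod_filter_val_lt_succ ⟨j, hj⟩]
    congr 1
    refine prod_eq_pow_card (fun t ht => ?_) |>.trans (by rw [card_range])
    have ht := mem_range.1 ht
    rw [part_eq_succ m (Nat.le_add_right _ _) (by simp only at hsucc; lia)]

@[to_additive]
theorem prod_part {R : Type*} [CommMonoid R] (g : ℕ → R) :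
    ∏ t : Fin (numParts m), g (part m t) = ∏ j : Fin k, g (j + 1) ^ m j := by
  rw [Fin.prod_univ_eq_prod_range (fun t => g (part m t)), numParts, prod_range_part m g le_rfl,
    filter_true_of_mem fun i _ => i.2]

theorem sum_part_eq_weight : ∑ t : Fin (numParts m), part m t = weight m := by
  simpa only [weight, smul_eq_mul, mul_comm, id] using sum_part m id

end Parts

section FiberSum

variable {ι κ S : Type*} [Fintype ι] [DecidableEq κ] [AddCommMonoid S]

/-- The vector indexed by `κ` of the sums of the coordinates of `b` over the fibres of `f`. -/
def fiberSum (f : ι → κ) (b : ι → S) (i : κ) : S := ∑ t with f t = i, b t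

theorem sum_fiberSum [Fintype κ] (f : ι → κ) (b : ι → S) : ∑ i, fiberSum f b i = ∑ t, b t :=
  Finset.sum_fiberwise _ _ _

theorem prod_pow_fiberSum {R : Type*} [CommMonoid R] [Fintype κ] (f : ι → κ) (b : ι → ℕ)
    (x : κ → R) : ∏ i, x i ^ fiberSum f b i = ∏ t, x (f t) ^ b t := by
  rw [← Finset.prod_fiberwise _ f]
  refine Finset.prod_congr rfl fun i _ => ?_
  rw [fiberSum, ← Finset.prod_pow_eq_pow_sum]
  exact Finset.prod_congr rfl fun t ht => by rw [(Finset.mem_filter.1 ht).2]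

end FiberSum

section Coloring

open Finset

variable {ι : Type*} [Fintype ι] [DecidableEq ι] {k : ℕ} (a : ι → ℝ)

theorem factorial_smul_cycleMonomial {R : Type*} [CommSemiring R] [Algebra ℝ R] (x : ι → R)
    (m : Fin k → ℕ) :
    (k ! : ℝ) • cycleMonomial (fun j => ∑ i, a i • x i ^ j) m =
      ewensCoeff m • ∑ f : Fin (numParts m) → ι,
        (∏ t, a (f t)) • ∏ i, x i ^ fiberSum f (fun t => part m t) i := by
  rw [cycleMonomial, prod_smul, prod_inv_distrib, smul_smul, ← div_eq_mul_inv, ewensCoeff,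
    ← prod_part m fun j => ∑ i, a i • x i ^ j, prod_univ_sum, Fintype.piFinset_univ]
  simp_rw [prod_smul, prod_pow_fiberSum]

theorem sum_ewensCoeff_smul_coloring {R : Type*} [CommSemiring R] [Algebra ℝ R] (x : ι → R) :
    ∑ m ∈ ofWeight k k, ewensCoeff m • ∑ f : Fin (numParts m) → ι,
        (∏ t, a (f t)) • ∏ i, x i ^ fiberSum f (fun t => part m t) i =
      ∑ b ∈ piAntidiag univ k,
        ((k ! : ℝ) * ∏ i, poch (a i) (b i) / ((b i)! : ℝ)) • ∏ i, x i ^ b i := by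
  simp_rw [← factorial_smul_cycleMonomial, ← smul_sum, sum_cycleMonomial_eq_sum_pochMonomial,
    smul_sum, pochMonomial, prod_smul, smul_smul]

theorem sum_ewensCoeff_mul_coloring_eq {b : ι → ℕ} (hb : ∑ i, b i = k) :
    ∑ m ∈ ofWeight k k, ewensCoeff m *
        ∑ f ∈ univ.filter fun f : Fin (numParts m) → ι => fiberSum f (fun t => part m t) = b,
          ∏ t, a (f t) =
      (k ! : ℝ) * ∏ i, poch (a i) (b i) / ((b i)! : ℝ) := by
  have hcoeff (c : ι → ℕ) : MvPolynomial.coeff (Finsupp.equivFunOnFinite.symm b)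
      (∏ i, (MvPolynomial.X i : MvPolynomial ι ℝ) ^ c i) = if c = b then 1 else 0 := by
    have hc : ∏ i, (MvPolynomial.X i : MvPolynomial ι ℝ) ^ c i =
        MvPolynomial.monomial (Finsupp.equivFunOnFinite.symm c) 1 := by
      simp [MvPolynomial.monomial_eq, Finsupp.prod_fintype]
    simp [hc, MvPolynomial.coeff_monomial]
  have h := congrArg (MvPolynomial.coeff (Finsupp.equivFunOnFinite.symm b))
    (sum_ewensCoeff_smul_coloring (k := k) a (MvPolynomial.X (R := ℝ)))
  simp only [MvPolynomial.coeff_sum, MvPolynomial.coeff_smul, hcoeff, smul_eq_mul, mul_ite,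
    mul_one, mul_zero, sum_ite_eq', mem_piAntidiag, hb, mem_univ, implies_true, and_self,
    if_true] at h
  simpa only [sum_filter] using h

theorem sum_ewensCoeff_mul_pow (k : ℕ) (x : ℝ) :
    ∑ m ∈ ofWeight k k, ewensCoeff m * x ^ ∑ j, m j = poch x k := by
  have h := sum_ewensCoeff_smul_coloring (k := k) (fun _ : Fin 1 => x) (fun _ => (1 : ℝ))
  rw [piAntidiag_univ_fin_eq_antidiagonalTuple, Finset.Nat.antidiagonalTuple_one] at h
  simpa [numParts_eq_sum, mul_div_cancel₀, Nat.factorial_ne_zero] using h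

variable {a}

theorem ewensCoeff_nonneg (m : Fin k → ℕ) : 0 ≤ ewensCoeff m := by
  unfold ewensCoeff
  positivity

theorem ofReal_smul_sum_coloring {V : Type*} [AddCommMonoid V] [Module ℝ≥0∞ V]
    (ha : ∀ i, 0 ≤ a i) {A : ℝ} (hA : 0 < A) {c : ℝ} (hc : 0 ≤ c) {m : Fin k → ℕ}
    (hm : weight m = k) (v : (ι → ℕ) → V) :
    ENNReal.ofReal (c * A ^ ∑ j, m j) • ∑ f : Fin (numParts m) → ι,
        (∏ t, ENNReal.ofReal (a (f t) / A)) • v (fiberSum f fun t => part m t) =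
      ∑ b ∈ piAntidiag univ k,
        ENNReal.ofReal (c *
          ∑ f ∈ univ.filter fun f : Fin (numParts m) → ι => fiberSum f (fun t => part m t) = b,
            ∏ t, a (f t)) • v b := by
  have hmaps : ∀ f ∈ (univ : Finset (Fin (numParts m) → ι)),
      fiberSum f (fun t => part m t) ∈ piAntidiag univ k := by
    simp [sum_fiberSum, sum_part_eq_weight, hm]
  rw [smul_sum, ← sum_fiberwise_of_maps_to hmaps]
  refine sum_congr rfl fun b _ => ?_
  rw [mul_sum, ENNReal.ofReal_sum_of_nonneg
    fun f _ => mul_nonneg hc (prod_nonneg fun t _ => ha (f t)), sum_smul]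
  refine sum_congr rfl fun f hf => ?_
  rw [(mem_filter.1 hf).2, smul_smul,
    ← ENNReal.ofReal_prod_of_nonneg fun t _ => div_nonneg (ha (f t)) hA.le,
    ← ENNReal.ofReal_mul (by positivity), prod_div_distrib, prod_const, card_univ,
    Fintype.card_fin, ← numParts_eq_sum]
  congr 2
  field_simp

theorem sum_ewens_smul_sum_coloring {V : Type*} [AddCommMonoid V] [Module ℝ≥0∞ V]
    (ha : ∀ i, 0 ≤ a i) {A : ℝ} (hA : 0 < A) (v : (ι → ℕ) → V) :
    ∑ m ∈ ofWeight k k, ENNReal.ofReal (ewensCoeff m * A ^ (∑ j, m j) / poch A k) •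
        ∑ f : Fin (numParts m) → ι,
          (∏ t, ENNReal.ofReal (a (f t) / A)) • v (fiberSum f fun t => part m t) =
      ∑ b ∈ piAntidiag univ k,
        ENNReal.ofReal ((k ! : ℝ) / poch A k * ∏ i, poch (a i) (b i) / ((b i)! : ℝ)) • v b := by
  have hpoch := poch_pos hA k
  have hcoeff (m : Fin k → ℕ) : 0 ≤ ewensCoeff m / poch A k :=
    div_nonneg (ewensCoeff_nonneg m) hpoch.le
  simp_rw [mul_div_right_comm (ewensCoeff _)]
  rw [sum_congr rfl fun m hm =>
    ofReal_smul_sum_coloring ha hA (hcoeff m) (mem_ofWeight.1 hm) v, sum_comm]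
  refine sum_congr rfl fun b hb => ?_
  rw [← sum_smul, ← ENNReal.ofReal_sum_of_nonneg fun m _ => mul_nonneg (hcoeff m)
    (sum_nonneg fun f _ => prod_nonneg fun t _ => ha (f t)), div_mul_eq_mul_div,
    ← sum_ewensCoeff_mul_coloring_eq a (mem_piAntidiag.1 hb).1, sum_div]
  simp_rw [div_mul_eq_mul_div]

end Coloring

section PiDensity

variable {E : Type*} [MeasurableSpace E]

theorem lintegral_fin_prod_eq_prod {n : ℕ} {μ : Fin n → Measure E} [∀ i, SigmaFinite (μ i)]
    {f : Fin n → E → ℝ≥0∞} (hf : ∀ i, Measurable (f i)) :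
    ∫⁻ x, ∏ i, f i (x i) ∂(Measure.pi μ) = ∏ i, ∫⁻ x, f i x ∂(μ i) := by
  induction n with
  | zero => simp
  | succ n ih =>
    rw [← ((measurePreserving_piFinSuccAbove μ 0).symm).lintegral_comp_emb
      (MeasurableEquiv.measurableEmbedding _), Fin.prod_univ_succ, ← ih fun i => hf i.succ]
    simp_rw [MeasurableEquiv.piFinSuccAbove_symm_apply, Fin.insertNthEquiv, Fin.prod_univ_succ,
      Fin.insertNth_zero, Equiv.coe_fn_mk, Fin.cons_succ, Fin.cons_zero]
    exact lintegral_prod_mul (hf 0).aemeasurable (Finset.measurable_prod _ fun (i : Fin n) _ =>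
      (hf i.succ).comp (measurable_pi_apply i)).aemeasurable

theorem measurable_option_elim {ι : Type*} :
    Measurable fun (p : E × (ι → E)) (t : Option ι) => t.elim p.1 p.2 := by
  refine measurable_pi_lambda _ fun t => ?_
  cases t with
  | none => exact measurable_fst
  | some j => exact (measurable_pi_apply j).comp measurable_snd

variable {ι : Type*} [Fintype ι]

theorem lintegral_fintype_prod_eq_prod {μ : ι → Measure E} [∀ i, SigmaFinite (μ i)]
    {f : ι → E → ℝ≥0∞} (hf : ∀ i, Measurable (f i)) :
    ∫⁻ x, ∏ i, f i (x i) ∂(Measure.pi μ) = ∏ i, ∫⁻ x, f i x ∂(μ i) := by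
  let e := (Fintype.equivFin ι).symm
  rw [← (measurePreserving_piCongrLeft μ e).lintegral_comp_emb
    (MeasurableEquiv.measurableEmbedding _)]
  simp_rw [← e.prod_comp, MeasurableEquiv.coe_piCongrLeft, Equiv.piCongrLeft_apply_apply]
  exact lintegral_fin_prod_eq_prod fun i => hf _

theorem pi_withDensity {μ : ι → Measure E} [∀ i, SigmaFinite (μ i)] {g : ι → E → ℝ≥0∞}
    (hg : ∀ i, Measurable (g i)) [∀ i, SigmaFinite ((μ i).withDensity (g i))] :
    Measure.pi (fun i => (μ i).withDensity (g i)) =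
      (Measure.pi μ).withDensity fun x => ∏ i, g i (x i) := by
  classical
  refine Measure.pi_eq fun s hs => ?_
  have hindicator : (Set.univ.pi s).indicator (fun x => ∏ i, g i (x i)) =
      fun x => ∏ i, (s i).indicator (g i) (x i) := by
    ext x
    simp only [Set.indicator_apply, Set.mem_univ_pi, Finset.prod_ite_zero, Finset.mem_univ,
      true_implies]
  rw [withDensity_apply _ (MeasurableSet.univ_pi hs),
    ← lintegral_indicator (MeasurableSet.univ_pi hs), hindicator,
    lintegral_fintype_prod_eq_prod fun i => (hg i).indicator (hs i)]
  simp_rw [withDensity_apply _ (hs _), lintegral_indicator (hs _)]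

theorem pi_option_eq_map (μ : Option ι → Measure E) [∀ t, SigmaFinite (μ t)] :
    Measure.pi μ = ((μ none).prod (Measure.pi fun j => μ (some j))).map
      fun p t => t.elim p.1 p.2 := by
  refine Measure.pi_eq fun s hs => ?_
  have hpre : (fun (p : E × (ι → E)) (t : Option ι) => t.elim p.1 p.2) ⁻¹' Set.univ.pi s =
      s none ×ˢ Set.univ.pi fun j => s (some j) := by
    ext p
    simp [Set.mem_pi, Option.forall]
  rw [Measure.map_apply measurable_option_elim (MeasurableSet.univ_pi hs), hpre,
    Measure.prod_prod, Measure.pi_pi, Fintype.prod_option]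

end PiDensity

section Polar

variable {ι : Type*} [Fintype ι]

/-- The vector `y` divided by the sum of its coordinates. -/
noncomputable def normalize (y : ι → ℝ) : ι → ℝ := fun i => y i / ∑ l, y l

@[fun_prop]
theorem measurable_normalize : Measurable (normalize : (ι → ℝ) → ι → ℝ) := by
  unfold normalize
  fun_prop

theorem normalize_smul {s : ℝ} (hs : s ≠ 0) {y : ι → ℝ} (hy : ∑ i, y i = 1) :
    normalize (s • y) = y := by
  ext i
  simp only [normalize, Pi.smul_apply, smul_eq_mul, ← Finset.mul_sum, hy, mul_one]
  field_simp

/-- The point of the hyperplane `∑ z = 1` given by all its coordinates but one. -/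
def completePoint (x : ι → ℝ) (t : Option ι) : ℝ := t.elim (1 - ∑ j, x j) x

@[fun_prop]
theorem measurable_completePoint : Measurable (completePoint : (ι → ℝ) → Option ι → ℝ) :=
  measurable_option_elim.comp (by fun_prop : Measurable fun x : ι → ℝ => (1 - ∑ j, x j, x))

theorem sum_completePoint (x : ι → ℝ) : ∑ t, completePoint x t = 1 := by
  simp [completePoint, Fintype.sum_option]

theorem lintegral_eq_ofReal_pow_mul_lintegral_smul {s : ℝ} (hs : 0 < s) {F : (ι → ℝ) → ℝ≥0∞}
    (hF : Measurable F) :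
    ∫⁻ x, F x = ENNReal.ofReal (s ^ Fintype.card ι) * ∫⁻ x : ι → ℝ, F (s • x) := by
  rw [← lintegral_map hF (by fun_prop : Measurable fun x : ι → ℝ => s • x),
    Measure.map_addHaar_smul volume hs.ne', lintegral_smul_measure, smul_eq_mul,
    ← mul_assoc, ← ENNReal.ofReal_mul (by positivity), Module.finrank_fintype_fun_eq_card,
    abs_of_pos (by positivity), mul_inv_cancel₀ (by positivity), ENNReal.ofReal_one, one_mul]

theorem lintegral_option_eq_lintegral_slice {F : (Option ι → ℝ) → ℝ≥0∞} (hF : Measurable F) :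
    ∫⁻ y, F y = ∫⁻ s, ∫⁻ x : ι → ℝ, F fun t => t.elim (s - ∑ j, x j) x := by
  have hslice : Measurable fun (p : (ι → ℝ) × ℝ) (t : Option ι) => t.elim (p.2 - ∑ j, p.1 j) p.1 :=
    measurable_option_elim.comp
      (by fun_prop : Measurable fun p : (ι → ℝ) × ℝ => (p.2 - ∑ j, p.1 j, p.1))
  calc ∫⁻ y, F y
      = ∫⁻ x : ι → ℝ, ∫⁻ s, F fun t => t.elim s x := by
        rw [volume_pi, pi_option_eq_map, lintegral_map hF measurable_option_elim]
        exact lintegral_prod_symm' _ (hF.comp measurable_option_elim)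
    _ = ∫⁻ x : ι → ℝ, ∫⁻ s, F fun t => t.elim (s - ∑ j, x j) x :=
        lintegral_congr fun x =>
          (lintegral_sub_right_eq_self (fun s => F fun t => t.elim s x) (∑ j, x j)).symm
    _ = ∫⁻ s, ∫⁻ x : ι → ℝ, F fun t => t.elim (s - ∑ j, x j) x :=
        lintegral_lintegral_swap (hF.comp hslice).aemeasurable

theorem lintegral_option_eq_lintegral_smul_completePoint {F : (Option ι → ℝ) → ℝ≥0∞}
    (hF : Measurable F) (hpos : ∀ y t, y t ≤ 0 → F y = 0) :
    ∫⁻ y, F y = ∫⁻ s in Set.Ioi 0,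
      ENNReal.ofReal (s ^ Fintype.card ι) * ∫⁻ x : ι → ℝ, F (s • completePoint x) := by
  rw [lintegral_option_eq_lintegral_slice hF, ← lintegral_indicator measurableSet_Ioi]
  refine lintegral_congr fun s => ?_
  by_cases hs : 0 < s
  · have hslice : Measurable fun x : ι → ℝ => F fun t => t.elim (s - ∑ j, x j) x :=
      hF.comp (measurable_option_elim.comp
        (by fun_prop : Measurable fun x : ι → ℝ => (s - ∑ j, x j, x)))
    rw [Set.indicator_of_mem (Set.mem_Ioi.2 hs),
      lintegral_eq_ofReal_pow_mul_lintegral_smul hs hslice]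
    congr! 4 with x
    ext t
    cases t <;> simp [completePoint, mul_sub, Finset.mul_sum]
  · rw [Set.indicator_of_notMem (by simpa using hs)]
    refine (lintegral_congr fun x => ?_).trans lintegral_zero
    by_contra h
    have hx : ∀ t : Option ι, 0 < t.elim (s - ∑ j, x j) x := fun t =>
      not_le.1 fun ht => h (hpos _ t ht)
    have hsum : 0 ≤ ∑ j, x j := Finset.sum_nonneg fun j _ => (hx (some j)).le
    have hnone : 0 < s - ∑ j, x j := hx none
    linarith

end Polar

section Gamma

open scoped NNReal

/-- The density of the gamma distribution with shape `a` and unit scale, taken to vanish at `0`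
(unlike `gammaPDF 1 1`), so that it is carried by the open half-line for every `a`. -/
noncomputable def gammaDensity (a : ℝ) : ℝ → ℝ≥0∞ :=
  (Set.Ioi 0).indicator fun x =>
    ENNReal.ofReal ((Real.Gamma a)⁻¹ * x ^ (a - 1) * Real.exp (-x))

@[fun_prop]
theorem measurable_gammaDensity (a : ℝ) : Measurable (gammaDensity a) :=
  Measurable.indicator (by fun_prop) measurableSet_Ioi

theorem gammaDensity_of_nonpos (a : ℝ) {x : ℝ} (hx : x ≤ 0) : gammaDensity a x = 0 :=
  Set.indicator_of_notMem (Set.notMem_Ioi.2 hx) _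

theorem gammaDensity_of_pos (a : ℝ) {x : ℝ} (hx : 0 < x) :
    gammaDensity a x = ENNReal.ofReal ((Real.Gamma a)⁻¹ * x ^ (a - 1) * Real.exp (-x)) :=
  Set.indicator_of_mem (Set.mem_Ioi.2 hx) _

theorem gammaDensity_ae_eq_gammaPDF (a : ℝ) : gammaDensity a =ᵐ[volume] gammaPDF a 1 := by
  filter_upwards [Measure.ae_ne volume (0 : ℝ)] with x hx
  obtain hx | hx := hx.lt_or_gt
  · rw [gammaDensity_of_nonpos a hx.le, gammaPDF_of_neg hx]
  · simp [gammaDensity_of_pos a hx, gammaPDF_of_nonneg hx.le]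

theorem lintegral_gammaDensity {a : ℝ} (ha : 0 < a) : ∫⁻ x, gammaDensity a x = 1 := by
  rw [lintegral_congr_ae (gammaDensity_ae_eq_gammaPDF a), lintegral_gammaPDF_eq_one ha one_pos]

/-- The gamma distribution with shape `a` and unit scale, which is the point mass at zero
for `a = 0`. -/
noncomputable def gammaLaw (a : ℝ≥0) : Measure ℝ :=
  if a = 0 then Measure.dirac 0 else volume.withDensity (gammaDensity a)

theorem gammaLaw_zero : gammaLaw 0 = Measure.dirac 0 := if_pos rfl

theorem gammaLaw_of_ne_zero {a : ℝ≥0} (ha : a ≠ 0) :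
    gammaLaw a = volume.withDensity (gammaDensity a) := if_neg ha

instance isProbabilityMeasure_gammaLaw (a : ℝ≥0) : IsProbabilityMeasure (gammaLaw a) := by
  obtain rfl | ha := eq_or_ne a 0
  · rw [gammaLaw_zero]
    infer_instance
  · rw [gammaLaw_of_ne_zero ha]
    exact ⟨by simp [lintegral_gammaDensity (NNReal.coe_pos.2 ha.bot_lt)]⟩

theorem ae_gammaLaw_pos {a : ℝ≥0} (ha : a ≠ 0) : ∀ᵐ x ∂gammaLaw a, 0 < x := by
  rw [gammaLaw_of_ne_zero ha, ae_withDensity_iff (measurable_gammaDensity a)]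
  exact .of_forall fun x hx => not_le.1 fun h => hx (gammaDensity_of_nonpos a h)

theorem ae_gammaLaw_nonneg (a : ℝ≥0) : ∀ᵐ x ∂gammaLaw a, 0 ≤ x := by
  obtain rfl | ha := eq_or_ne a 0
  · rw [gammaLaw_zero, ae_dirac_iff measurableSet_Ici]
  · exact (ae_gammaLaw_pos ha).mono fun x => le_of_lt

/-- The Dirichlet density with positive parameters, as a function of all the coordinates of a
point of the simplex. -/
noncomputable def fullDirichletDensity {T : Type*} [Fintype T] (a z : T → ℝ) : ℝ≥0∞ :=
  open Classical in
  if ∀ t, 0 < z t then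
    ENNReal.ofReal (Real.Gamma (∑ t, a t) / (∏ t, Real.Gamma (a t)) * ∏ t, z t ^ (a t - 1))
  else 0

@[fun_prop]
theorem measurable_fullDirichletDensity {T : Type*} [Fintype T] (a : T → ℝ) :
    Measurable (fullDirichletDensity a) := by
  unfold fullDirichletDensity
  have hpos : MeasurableSet {z : T → ℝ | ∀ t, 0 < z t} := by
    simp_rw [Set.ofPred_forall]
    exact MeasurableSet.iInter fun t => measurableSet_lt measurable_const (measurable_pi_apply t)
  exact Measurable.ite hpos (by fun_prop) measurable_const

theorem prod_gammaDensity_smul {T : Type*} [Fintype T] [Nonempty T] {a z : T → ℝ}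
    (ha : ∀ t, 0 < a t) (hz : ∑ t, z t = 1) {s : ℝ} (hs : 0 < s) :
    ENNReal.ofReal (s ^ (Fintype.card T - 1)) * ∏ t, gammaDensity (a t) (s * z t) =
      gammaDensity (∑ t, a t) s * fullDirichletDensity a z := by
  have hΓ (t : T) : 0 < Real.Gamma (a t) := Real.Gamma_pos_of_pos (ha t)
  have hΓsum : 0 < Real.Gamma (∑ t, a t) :=
    Real.Gamma_pos_of_pos (Finset.sum_pos (fun t _ => ha t) Finset.univ_nonempty)
  by_cases h : ∀ t, 0 < z t
  · have hexp : ∏ t, Real.exp (-(s * z t)) = Real.exp (-s) := by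
      rw [← Real.exp_sum, Finset.sum_neg_distrib, ← Finset.mul_sum, hz, mul_one]
    have hpow : s ^ (Fintype.card T - 1) * ∏ t, (s * z t) ^ (a t - 1) =
        s ^ (∑ t, a t - 1) * ∏ t, z t ^ (a t - 1) := by
      simp_rw [fun t => Real.mul_rpow (z := a t - 1) hs.le (h t).le]
      rw [Finset.prod_mul_distrib, ← Real.rpow_sum_of_pos hs, ← mul_assoc, ← Real.rpow_natCast,
        ← Real.rpow_add hs, Nat.cast_sub Fintype.card_pos]
      simp
    have hnonneg (t : T) : 0 ≤ (Real.Gamma (a t))⁻¹ * (s * z t) ^ (a t - 1) *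
        Real.exp (-(s * z t)) := by
      have := h t
      have := hΓ t
      positivity
    simp_rw [fun t => gammaDensity_of_pos (a t) (mul_pos hs (h t))]
    rw [← ENNReal.ofReal_prod_of_nonneg fun t _ => hnonneg t, ← ENNReal.ofReal_mul (by positivity),
      gammaDensity_of_pos _ hs, fullDirichletDensity, if_pos h,
      ← ENNReal.ofReal_mul (by positivity), Finset.prod_mul_distrib, Finset.prod_mul_distrib, hexp,
      Finset.prod_inv_distrib]
    congr 1
    linear_combination ((∏ t, Real.Gamma (a t))⁻¹ * Real.exp (-s)) * hpow +
      ((∏ t, Real.Gamma (a t))⁻¹ * Real.exp (-s)) * s ^ (∑ t, a t - 1) *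
        (∏ t, z t ^ (a t - 1)) * (mul_inv_cancel₀ hΓsum.ne').symm
  · rw [fullDirichletDensity, if_neg h, mul_zero]
    obtain ⟨t, ht⟩ := not_forall.1 h
    rw [Finset.prod_eq_zero (Finset.mem_univ t), mul_zero]
    exact gammaDensity_of_nonpos _ (mul_nonpos_of_nonneg_of_nonpos hs.le (not_lt.1 ht))

theorem lintegral_gammaLaw {a : ℝ≥0} (ha : a ≠ 0) {h : ℝ → ℝ≥0∞} (hh : Measurable h) :
    ∫⁻ s, h s ∂gammaLaw a = ∫⁻ s in Set.Ioi 0, gammaDensity a s * h s := by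
  rw [gammaLaw_of_ne_zero ha, lintegral_withDensity_eq_lintegral_mul _ (by fun_prop) hh,
    ← lintegral_indicator measurableSet_Ioi]
  refine lintegral_congr fun s => ?_
  by_cases hs : s ∈ Set.Ioi (0 : ℝ)
  · rw [Set.indicator_of_mem hs, Pi.mul_apply]
  · rw [Set.indicator_of_notMem hs, Pi.mul_apply, gammaDensity_of_nonpos _ (not_lt.1 hs), zero_mul]

variable {J : Type*} [Fintype J]

theorem pi_gammaLaw {a : J → ℝ≥0} (ha : ∀ t, a t ≠ 0) :
    Measure.pi (fun t => gammaLaw (a t)) =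
      volume.withDensity fun y => ∏ t, gammaDensity (a t) (y t) := by
  have hfinite (t : J) : SigmaFinite ((volume : Measure ℝ).withDensity (gammaDensity (a t))) := by
    rw [← gammaLaw_of_ne_zero (ha t)]
    infer_instance
  simp_rw [fun t => gammaLaw_of_ne_zero (ha t)]
  exact pi_withDensity fun t => measurable_gammaDensity _

theorem lintegral_pi_gammaLaw {a : Option J → ℝ≥0} (ha : ∀ t, a t ≠ 0) {h : ℝ → ℝ≥0∞}
    (hh : Measurable h) {G : (Option J → ℝ) → ℝ≥0∞} (hG : Measurable G) :
    ∫⁻ y, h (∑ t, y t) * G (normalize y) ∂(Measure.pi fun t => gammaLaw (a t)) =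
      (∫⁻ s, h s ∂gammaLaw (∑ t, a t)) * ∫⁻ x : J → ℝ,
        fullDirichletDensity (fun t => (a t : ℝ)) (completePoint x) * G (completePoint x) := by
  set D : (J → ℝ) → ℝ≥0∞ := fun x =>
    fullDirichletDensity (fun t => (a t : ℝ)) (completePoint x) * G (completePoint x)
  have hD : Measurable D := by fun_prop
  have hprod : Measurable fun y : Option J → ℝ => ∏ t, gammaDensity (a t) (y t) := by fun_prop
  have hsum : ∑ t, a t ≠ 0 := fun h0 =>
    ha none (Finset.sum_eq_zero_iff.1 h0 none (Finset.mem_univ _))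
  have hpolar {s : ℝ} (hs : 0 < s) (x : J → ℝ) :
      ENNReal.ofReal (s ^ Fintype.card J) *
        ((∏ t, gammaDensity (a t) ((s • completePoint x) t)) *
          (h (∑ t, (s • completePoint x) t) * G (normalize (s • completePoint x)))) =
      gammaDensity (∑ t, (a t : ℝ)) s * h s * D x := by
    have hdensity := prod_gammaDensity_smul (fun t => NNReal.coe_pos.2 (ha t).bot_lt)
      (sum_completePoint x) hs
    rw [Fintype.card_option, Nat.add_sub_cancel] at hdensity
    rw [normalize_smul hs.ne' (sum_completePoint x), ← mul_assoc]
    simp_rw [Pi.smul_apply, smul_eq_mul]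
    rw [hdensity, ← Finset.mul_sum, sum_completePoint, mul_one]
    ring
  calc ∫⁻ y, h (∑ t, y t) * G (normalize y) ∂(Measure.pi fun t => gammaLaw (a t))
      = ∫⁻ y, (∏ t, gammaDensity (a t) (y t)) * (h (∑ t, y t) * G (normalize y)) := by
        rw [pi_gammaLaw ha, lintegral_withDensity_eq_lintegral_mul _ hprod (by fun_prop)]
        rfl
    _ = ∫⁻ s in Set.Ioi 0, gammaDensity (∑ t, (a t : ℝ)) s * h s * ∫⁻ x, D x := by
        rw [lintegral_option_eq_lintegral_smul_completePoint (by fun_prop) fun y t ht => by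
          rw [Finset.prod_eq_zero (Finset.mem_univ t) (gammaDensity_of_nonpos _ ht), zero_mul]]
        refine setLIntegral_congr_fun measurableSet_Ioi fun s hs => ?_
        rw [← lintegral_const_mul _ (by fun_prop), ← lintegral_const_mul _ hD]
        exact lintegral_congr (hpolar hs)
    _ = (∫⁻ s, h s ∂gammaLaw (∑ t, a t)) * ∫⁻ x, D x := by
        rw [lintegral_mul_const _ (by fun_prop), lintegral_gammaLaw hsum hh, NNReal.coe_sum]

theorem lintegral_fullDirichletDensity {a : Option J → ℝ≥0} (ha : ∀ t, a t ≠ 0) :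
    ∫⁻ x : J → ℝ, fullDirichletDensity (fun t => (a t : ℝ)) (completePoint x) = 1 := by
  simpa using (lintegral_pi_gammaLaw ha (h := 1) (G := 1) measurable_one measurable_one).symm

theorem map_sum_pi_gammaLaw {a : Option J → ℝ≥0} (ha : ∀ t, a t ≠ 0) :
    (Measure.pi fun t => gammaLaw (a t)).map (fun y => ∑ t, y t) = gammaLaw (∑ t, a t) := by
  refine Measure.ext_of_lintegral _ fun h hh => ?_
  rw [lintegral_map hh (by fun_prop)]
  simpa [lintegral_fullDirichletDensity ha] using
    lintegral_pi_gammaLaw ha hh (G := 1) measurable_one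

theorem lintegral_normalize_pi_gammaLaw {a : Option J → ℝ≥0} (ha : ∀ t, a t ≠ 0)
    {G : (Option J → ℝ) → ℝ≥0∞} (hG : Measurable G) :
    ∫⁻ y, G (normalize y) ∂(Measure.pi fun t => gammaLaw (a t)) = ∫⁻ x : J → ℝ,
      fullDirichletDensity (fun t => (a t : ℝ)) (completePoint x) * G (completePoint x) := by
  simpa using lintegral_pi_gammaLaw ha (h := 1) measurable_one hG

theorem charFunDual_gammaLaw_add (a b : ℝ≥0) (L : StrongDual ℝ ℝ) :
    charFunDual (gammaLaw (a + b)) L = charFunDual (gammaLaw a) L * charFunDual (gammaLaw b) L := by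
  obtain rfl | ha := eq_or_ne a 0
  · simp [gammaLaw_zero, charFunDual_dirac]
  obtain rfl | hb := eq_or_ne b 0
  · simp [gammaLaw_zero, charFunDual_dirac]
  let c : Option Unit → ℝ≥0 := fun t => t.elim a fun _ => b
  have hc (t) : c t ≠ 0 := by cases t <;> simpa [c]
  let sumCLM : (Option Unit → ℝ) →L[ℝ] ℝ := ∑ t, ContinuousLinearMap.proj t
  have hsum : (fun y : Option Unit → ℝ => ∑ t, y t) = sumCLM := by
    ext y
    simp [sumCLM]
  have hsingle (t) : (L.comp sumCLM).comp (.single ℝ (fun _ => ℝ) t) = L := by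
    ext
    cases t <;> simp [sumCLM]
  have h := congrArg (charFunDual · L) (map_sum_pi_gammaLaw hc)
  simp only [hsum, charFunDual_map, charFunDual_pi, hsingle] at h
  simpa [c, Fintype.sum_option, Fintype.prod_option] using h.symm

theorem charFunDual_gammaLaw_sum {ι : Type*} (s : Finset ι) (b : ι → ℝ≥0) (L : StrongDual ℝ ℝ) :
    charFunDual (gammaLaw (∑ t ∈ s, b t)) L = ∏ t ∈ s, charFunDual (gammaLaw (b t)) L := by
  classical
  induction s using Finset.induction_on with
  | empty => simp [gammaLaw_zero, charFunDual_dirac]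
  | insert t s ht ih =>
    rw [Finset.sum_insert ht, Finset.prod_insert ht, charFunDual_gammaLaw_add, ih]

end Gamma

section GammaFiberSum

open scoped NNReal

variable {ι κ : Type*} [Fintype ι] [DecidableEq κ]

@[fun_prop]
theorem measurable_fiberSum (f : ι → κ) : Measurable (fiberSum f : (ι → ℝ) → κ → ℝ) :=
  measurable_pi_lambda _ fun _ => Finset.measurable_sum _ fun t _ => measurable_pi_apply t

variable [Fintype κ]

theorem fiberSum_normalize (f : ι → κ) (y : ι → ℝ) :
    fiberSum f (normalize y) = normalize (fiberSum f y) := by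
  ext i
  simp only [normalize, sum_fiberSum]
  simp only [fiberSum, normalize, Finset.sum_div]

theorem map_fiberSum_pi_gammaLaw (f : ι → κ) (b : ι → ℝ≥0) :
    (Measure.pi fun t => gammaLaw (b t)).map (fiberSum f) =
      Measure.pi fun i => gammaLaw (fiberSum f b i) := by
  classical
  let fiberSumCLM : (ι → ℝ) →L[ℝ] (κ → ℝ) :=
    .pi fun i => ∑ t with f t = i, .proj t
  have hfiberSum : (fiberSum f : (ι → ℝ) → κ → ℝ) = fiberSumCLM := by
    ext x i
    simp [fiberSum, fiberSumCLM]
  have hsingle (t : ι) : fiberSumCLM (Pi.single t 1) = Pi.single (f t) 1 := by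
    ext i
    simp [fiberSumCLM, Pi.single_apply, eq_comm]
  have : IsProbabilityMeasure ((Measure.pi fun t => gammaLaw (b t)).map (fiberSum f)) :=
    Measure.isProbabilityMeasure_map (measurable_fiberSum f).aemeasurable
  refine Measure.ext_of_charFunDual (funext fun L => ?_)
  have hcomp (t : ι) : (L.comp fiberSumCLM).comp (.single ℝ (fun _ => ℝ) t) =
      L.comp (.single ℝ (fun _ => ℝ) (f t)) := by
    ext
    simp [hsingle]
  calc charFunDual ((Measure.pi fun t => gammaLaw (b t)).map (fiberSum f)) L
      = ∏ t, charFunDual (gammaLaw (b t)) (L.comp (.single ℝ (fun _ => ℝ) (f t))) := by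
        rw [hfiberSum, charFunDual_map, charFunDual_pi]
        simp_rw [hcomp]
    _ = ∏ i, ∏ t with f t = i,
          charFunDual (gammaLaw (b t)) (L.comp (.single ℝ (fun _ => ℝ) i)) := by
        rw [Finset.prod_comm' (t' := Finset.univ) (s' := fun t => {f t}) (by simp [eq_comm])]
        simp
    _ = charFunDual (Measure.pi fun i => gammaLaw (fiberSum f b i)) L := by
        simp_rw [charFunDual_pi, fiberSum, charFunDual_gammaLaw_sum]

end GammaFiberSum

section Face

variable {ι : Type*}

/-- The support of `a`, enumerated as in the definition of `dirichletDensity`: the distinguished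
index `i₀` followed by the indices of the free coordinates. -/
def faceIndex (a : ι → ℝ) (i₀ : ι) (t : Option {i : ι // 0 < a i ∧ i ≠ i₀}) : ι :=
  t.elim i₀ Subtype.val

theorem faceIndex_pos {a : ι → ℝ} {i₀ : ι} (h₀ : 0 < a i₀)
    (t : Option {i : ι // 0 < a i ∧ i ≠ i₀}) : 0 < a (faceIndex a i₀ t) := by
  cases t with
  | none => exact h₀
  | some j => exact j.2.1

theorem exists_faceIndex_eq (a : ι → ℝ) (i₀ : ι) {i : ι} (hi : 0 < a i) :
    ∃ t, faceIndex a i₀ t = i := by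
  by_cases h : i = i₀
  · exact ⟨none, h.symm⟩
  · exact ⟨some ⟨i, hi, h⟩, rfl⟩

theorem faceIndex_injective (a : ι → ℝ) (i₀ : ι) : Function.Injective (faceIndex a i₀) := by
  rintro (_ | s) (_ | t) h
  · rfl
  · exact absurd h.symm t.2.2
  · exact absurd h s.2.2
  · exact congrArg some (Subtype.ext h)

variable (a : ι → ℝ) {i₀ : ι}

theorem fiberSum_comp_faceIndex [DecidableEq ι] [Fintype {i : ι // 0 < a i ∧ i ≠ i₀}] {S : Type*}
    [AddCommMonoid S] {g : ι → S} (h₀ : 0 < a i₀) (hg : ∀ i, ¬ 0 < a i → g i = 0) :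
    fiberSum (faceIndex a i₀) (g ∘ faceIndex a i₀) = g := by
  ext i
  by_cases hi : 0 < a i
  · obtain ⟨t, rfl⟩ := exists_faceIndex_eq a i₀ hi
    simp [fiberSum, (faceIndex_injective a i₀).eq_iff, Finset.filter_eq']
  · rw [hg i hi, fiberSum]
    refine Finset.sum_eq_zero fun t ht => absurd (faceIndex_pos h₀ t) ?_
    rwa [(Finset.mem_filter.1 ht).2]

variable [Fintype ι]

theorem simplexPoint_of_not_pos (h₀ : 0 < a i₀) (x : {i : ι // 0 < a i ∧ i ≠ i₀} → ℝ) {i : ι}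
    (hi : ¬ 0 < a i) : simplexPoint a i₀ x i = 0 := by
  have hne : i ≠ i₀ := by
    rintro rfl
    exact hi h₀
  simp [simplexPoint, hi, hne]

variable [Fintype {i : ι // 0 < a i ∧ i ≠ i₀}]

@[to_additive]
theorem prod_support_eq_prod_faceIndex {S : Type*} [CommMonoid S] (h₀ : 0 < a i₀) (g : ι → S) :
    ∏ i with 0 < a i, g i = ∏ t, g (faceIndex a i₀ t) := by
  refine (Finset.prod_bij (fun t _ => faceIndex a i₀ t) (fun t _ => ?_)
    (fun s _ t _ => @faceIndex_injective _ a i₀ s t) (fun i hi => ?_) fun _ _ => rfl).symm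
  · simpa using faceIndex_pos h₀ t
  · simpa using exists_faceIndex_eq a i₀ (Finset.mem_filter.1 hi).2

theorem simplexPoint_faceIndex (x : {i : ι // 0 < a i ∧ i ≠ i₀} → ℝ)
    (t : Option {i : ι // 0 < a i ∧ i ≠ i₀}) :
    simplexPoint a i₀ x (faceIndex a i₀ t) = completePoint x t := by
  cases t with
  | none =>
    have h : simplexPoint a i₀ x i₀ = 1 - ∑ j, x j := by
      rw [simplexPoint, dif_neg fun h => h.2 rfl, if_pos rfl]
      congr!
    exact h
  | some j => simp [simplexPoint, completePoint, faceIndex, j.2]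

theorem simplexPoint_eq_fiberSum [DecidableEq ι] (h₀ : 0 < a i₀)
    (x : {i : ι // 0 < a i ∧ i ≠ i₀} → ℝ) :
    simplexPoint a i₀ x = fiberSum (faceIndex a i₀) (completePoint x) := by
  rw [← funext (simplexPoint_faceIndex a x)]
  exact (fiberSum_comp_faceIndex a h₀ fun i => simplexPoint_of_not_pos a h₀ x).symm

theorem dirichletDensity_eq (h₀ : 0 < a i₀) (x : {i : ι // 0 < a i ∧ i ≠ i₀} → ℝ) :
    dirichletDensity a i₀ x =
      fullDirichletDensity (a ∘ faceIndex a i₀) (completePoint x) := by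
  have hpos : (∀ i, 0 < a i → 0 < simplexPoint a i₀ x i) ↔ ∀ t, 0 < completePoint x t := by
    simp_rw [← simplexPoint_faceIndex]
    refine ⟨fun h t => h _ (faceIndex_pos h₀ t), fun h i hi => ?_⟩
    obtain ⟨t, rfl⟩ := exists_faceIndex_eq a i₀ hi
    exact h t
  simp only [dirichletDensity, fullDirichletDensity, hpos, sum_support_eq_sum_faceIndex a h₀,
    prod_support_eq_prod_faceIndex a h₀, simplexPoint_faceIndex, Function.comp_apply]

end Face

section Dirichlet

open scoped NNReal

theorem map_simplexPoint_eq_map_normalize {ι : Type*} [Fintype ι] {b : ι → ℝ≥0} {i₀ : ι}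
    (h₀ : b i₀ ≠ 0) [Fintype {i : ι // 0 < (b i : ℝ) ∧ i ≠ i₀}] :
    (volume.withDensity (dirichletDensity (fun i => (b i : ℝ)) i₀)).map
      (simplexPoint (fun i => (b i : ℝ)) i₀) =
    (Measure.pi fun i => gammaLaw (b i)).map normalize := by
  classical
  set a : ι → ℝ := fun i => b i
  set e := faceIndex a i₀
  have h₀' : 0 < a i₀ := NNReal.coe_pos.2 h₀.bot_lt
  have he (t) : b (e t) ≠ 0 := (NNReal.coe_pos.1 (faceIndex_pos h₀' t)).ne'
  have hb : fiberSum e (b ∘ e) = b :=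
    fiberSum_comp_faceIndex a h₀' fun i hi => by simpa [a] using hi
  have hpi : Measure.pi (fun i => gammaLaw (b i)) =
      (Measure.pi fun t => gammaLaw (b (e t))).map (fiberSum e) := by
    rw [map_fiberSum_pi_gammaLaw e fun t => b (e t)]
    exact congrArg (fun c : ι → ℝ≥0 => Measure.pi fun i => gammaLaw (c i)) hb.symm
  rw [hpi, Measure.map_map measurable_normalize (measurable_fiberSum e),
    funext (dirichletDensity_eq a h₀'), funext (simplexPoint_eq_fiberSum a h₀')]
  refine Measure.ext_of_lintegral _ fun g hg => ?_
  rw [lintegral_map hg (by fun_prop), lintegral_map hg (by fun_prop),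
    lintegral_withDensity_eq_lintegral_mul _ (by fun_prop) (by fun_prop)]
  simp_rw [Function.comp_apply, ← fiberSum_normalize]
  exact (lintegral_normalize_pi_gammaLaw he (hg.comp (measurable_fiberSum e))).symm

variable {n : ℕ}

theorem dirichlet_eq_map_normalize {b : Fin n → ℝ≥0} (hb : ∑ i, b i ≠ 0) :
    dirichlet (fun i => (b i : ℝ)) = (Measure.pi fun i => gammaLaw (b i)).map normalize := by
  classical
  obtain ⟨i, -, hi⟩ := Finset.exists_ne_zero_of_sum_ne_zero hb
  have hsupport : (Finset.univ.filter fun i => 0 < (b i : ℝ)).Nonempty :=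
    ⟨i, by simpa using hi.bot_lt⟩
  have hmin := (Finset.mem_filter.1 (Finset.min'_mem _ hsupport)).2
  rw [← map_simplexPoint_eq_map_normalize (NNReal.coe_pos.1 hmin).ne', dirichlet,
    dif_pos hsupport]

theorem isProbabilityMeasure_dirichlet {b : Fin n → ℝ≥0} (hb : ∑ i, b i ≠ 0) :
    IsProbabilityMeasure (dirichlet fun i => (b i : ℝ)) := by
  rw [dirichlet_eq_map_normalize hb]
  exact Measure.isProbabilityMeasure_map (by fun_prop)

theorem ae_dirichlet_mem_stdSimplex {b : Fin n → ℝ≥0} (hb : ∑ i, b i ≠ 0) :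
    ∀ᵐ w ∂(dirichlet fun i => (b i : ℝ)), w ∈ stdSimplex ℝ (Fin n) := by
  obtain ⟨i, -, hi⟩ := Finset.exists_ne_zero_of_sum_ne_zero hb
  rw [dirichlet_eq_map_normalize hb]
  refine (ae_map_iff (by fun_prop) (isClosed_stdSimplex ℝ (Fin n)).measurableSet).2 ?_
  have hnonneg : ∀ᵐ y ∂(Measure.pi fun i => gammaLaw (b i)), ∀ l, 0 ≤ y l :=
    ae_all_iff.2 fun l => (Measure.tendsto_eval_ae_ae (μ := fun i => gammaLaw (b i))).eventually
      (ae_gammaLaw_nonneg (b l))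
  have hpos : ∀ᵐ y ∂(Measure.pi fun i => gammaLaw (b i)), 0 < y i :=
    (Measure.tendsto_eval_ae_ae (μ := fun i => gammaLaw (b i))).eventually (ae_gammaLaw_pos hi)
  filter_upwards [hnonneg, hpos] with y hy hyi
  have hsum : 0 < ∑ l, y l := Finset.sum_pos' (fun l _ => hy l) ⟨i, Finset.mem_univ i, hyi⟩
  refine ⟨fun l => div_nonneg (hy l) hsum.le, ?_⟩
  simp_rw [normalize, ← Finset.sum_div, div_self hsum.ne']

theorem map_fiberSum_dirichlet {l : ℕ} (f : Fin n → Fin l) {b : Fin n → ℝ≥0}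
    (hb : ∑ i, b i ≠ 0) :
    (dirichlet fun i => (b i : ℝ)).map (fiberSum f) =
      dirichlet fun i => ((fiberSum f b i : ℝ≥0) : ℝ) := by
  rw [dirichlet_eq_map_normalize hb, dirichlet_eq_map_normalize (by rwa [sum_fiberSum]),
    ← map_fiberSum_pi_gammaLaw, Measure.map_map (by fun_prop) (by fun_prop),
    Measure.map_map (by fun_prop) (by fun_prop)]
  exact congrArg (Measure.map · _) (funext fun y => fiberSum_normalize f y)

end Dirichlet

section Ewens

variable (k : ℕ) (a : ℝ)

theorem ewens_eq_sum :
    ewens k a = ∑ m ∈ ofWeight k k,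
      ENNReal.ofReal (ewensCoeff m * a ^ (∑ j, m j) / poch a k) • Measure.dirac m := by
  let e : {m : Fin k → ℕ // ∑ j : Fin k, ((j : ℕ) + 1) * m j = k} ≃ ofWeight k k :=
    Equiv.subtypeEquivRight fun m => mem_ofWeight.symm
  rw [← Measure.sum_coe_finset, ← Measure.sum_comp_equiv e]
  rfl

theorem ae_ewens_mem_ofWeight : ∀ᵐ m ∂(ewens k a), m ∈ ofWeight k k := by
  rw [ewens_eq_sum, ae_finsetSum_measure_iff]
  exact fun m hm => Measure.ae_smul_measure (ae_dirac_eq (a := m) ▸ hm) _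

variable {k}

theorem ewens_singleton {m : Fin k → ℕ} (hm : m ∈ ofWeight k k) :
    ewens k a {m} = ENNReal.ofReal (ewensCoeff m * a ^ (∑ j, m j) / poch a k) := by
  rw [ewens_eq_sum, Measure.finsetSum_apply, Finset.sum_eq_single_of_mem m hm
    fun m' _ hne => by simp [hne]]
  simp

theorem isProbabilityMeasure_ewens {a : ℝ} (ha : 0 < a) : IsProbabilityMeasure (ewens k a) := by
  have hpoch := poch_pos ha k
  constructor
  simp only [ewens_eq_sum, Measure.finsetSum_apply, Measure.smul_apply, measure_univ, smul_eq_mul,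
    mul_one]
  rw [← ENNReal.ofReal_sum_of_nonneg fun m _ => ?_, ← Finset.sum_div, sum_ewensCoeff_mul_pow,
    div_self hpoch.ne', ENNReal.ofReal_one]
  exact div_nonneg (mul_nonneg (ewensCoeff_nonneg m) (by positivity)) hpoch.le

end Ewens

section TotalProbability

variable {Θ κ : Type*} [MeasurableSpace Θ] (μ : Measure Θ) [IsFiniteMeasure μ]

theorem measure_smul_cond (s : Set Θ) :
    μ s • cond μ s = μ.restrict s := by
  obtain hs | hs := eq_or_ne (μ s) 0
  · rw [hs, zero_smul, Measure.restrict_eq_zero.2 hs]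
  · rw [ProbabilityTheory.cond, smul_smul, ENNReal.mul_inv_cancel hs (measure_ne_top μ s), one_smul]

variable {μ}

theorem sum_measure_smul_cond [MeasurableSpace κ] [MeasurableSingletonClass κ] {M : Θ → κ}
    (hM : Measurable M) {s : Finset κ} (hs : ∀ᵐ θ ∂μ, M θ ∈ s) :
    ∑ m ∈ s, μ (M ⁻¹' {m}) • cond μ (M ⁻¹' {m}) = μ := by
  simp_rw [measure_smul_cond]
  rw [← Measure.sum_coe_finset, ← Measure.restrict_biUnion_finset
    (Set.pairwiseDisjoint_fiber M s) fun m => hM (measurableSet_singleton m)]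
  refine Measure.restrict_eq_self_of_ae_mem (hs.mono fun θ hθ => ?_)
  exact Set.mem_biUnion (Finset.mem_coe.2 hθ) rfl

end TotalProbability

section RandomColoring

variable {Ω ι κ : Type*} [MeasurableSpace Ω]

theorem exists_measurable_coloring [Countable κ] [MeasurableSpace κ] {A : κ → Set Ω}
    (hA : ∀ i, MeasurableSet (A i)) (hdisj : Pairwise fun i j => Disjoint (A i) (A j))
    (hcover : ⋃ i, A i = Set.univ) :
    ∃ c : Ω → κ, Measurable c ∧ ∀ i, A i = c ⁻¹' {i} := by
  choose c hc using fun x => Set.mem_iUnion.1 (hcover ▸ Set.mem_univ x)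
  have hfiber (i : κ) : A i = c ⁻¹' {i} := by
    ext x
    refine ⟨fun hx => ?_, fun hx => hx ▸ hc x⟩
    by_contra hne
    exact Set.disjoint_left.1 (hdisj hne) (hc x) hx
  exact ⟨c, measurable_to_countable' fun i => hfiber i ▸ hA i, hfiber⟩

variable [Fintype ι] [DecidableEq κ] [MeasurableSpace κ] [MeasurableSingletonClass κ]

theorem measurable_uncurry_fiberSum [Countable κ] :
    Measurable fun q : (ι → κ) × (ι → ℝ) => fiberSum q.1 q.2 :=
  measurable_from_prod_countable_right fun f => measurable_fiberSum f

theorem map_fiberSum_coloring [Fintype κ] [DecidableEq ι] {c : Ω → κ} (hc : Measurable c)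
    (ρ : Measure Ω) [IsFiniteMeasure ρ] (D : Measure (ι → ℝ)) [SFinite D] :
    ((Measure.pi fun _ : ι => ρ).prod D).map (fun p => fiberSum (c ∘ p.1) p.2) =
      ∑ f : ι → κ, (∏ t, ρ (c ⁻¹' {f t})) • D.map (fiberSum f) := by
  have hcomp : Measurable fun x : ι → Ω => c ∘ x := by
    simp only [Function.comp_def]
    fun_prop
  have hfiberSum := measurable_uncurry_fiberSum (ι := ι) (κ := κ)
  have hcolors : (Measure.pi fun _ : ι => ρ).map (fun x => c ∘ x) =
      ∑ f : ι → κ, (∏ t, ρ (c ⁻¹' {f t})) • Measure.dirac f := by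
    rw [Measure.map_eq_sum _ _ hcomp, Measure.sum_fintype]
    refine Finset.sum_congr rfl fun f _ => ?_
    rw [← Measure.pi_pi]
    congr! 2
    ext x
    simp [funext_iff]
  calc ((Measure.pi fun _ : ι => ρ).prod D).map (fun p => fiberSum (c ∘ p.1) p.2)
      = (((Measure.pi fun _ : ι => ρ).map fun x => c ∘ x).prod D).map
          fun q => fiberSum q.1 q.2 := by
        conv_rhs => rw [← Measure.map_id (μ := D), Measure.map_prod_map _ _ hcomp measurable_id,
          Measure.map_map hfiberSum (hcomp.prodMap measurable_id)]
        rfl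
    _ = ∑ f : ι → κ, (∏ t, ρ (c ⁻¹' {f t})) • D.map (fiberSum f) := by
        rw [hcolors, ← Measure.sum_fintype, Measure.prod_sum_left,
          Measure.map_sum hfiberSum.aemeasurable, Measure.sum_fintype]
        refine Finset.sum_congr rfl fun f _ => ?_
        rw [Measure.prod_smul_left, Measure.map_smul, Measure.dirac_prod,
          Measure.map_map hfiberSum measurable_prodMk_left]
        rfl

end RandomColoring

section DirichletPart

open scoped NNReal

variable {k : ℕ} {m : Fin k → ℕ}

theorem sum_part_ne_zero (hm : weight m ≠ 0) : ∑ t : Fin (numParts m), (part m t : ℝ≥0) ≠ 0 := by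
  rwa [← Nat.cast_sum, sum_part_eq_weight, Nat.cast_ne_zero]

theorem isProbabilityMeasure_dirichlet_part (hm : weight m ≠ 0) :
    IsProbabilityMeasure (dirichlet fun t : Fin (numParts m) => (part m t : ℝ)) := by
  simpa using isProbabilityMeasure_dirichlet (sum_part_ne_zero hm)

theorem ae_dirichlet_part_mem_stdSimplex (hm : weight m ≠ 0) :
    ∀ᵐ w ∂(dirichlet fun t : Fin (numParts m) => (part m t : ℝ)),
      w ∈ stdSimplex ℝ (Fin (numParts m)) := by
  simpa using ae_dirichlet_mem_stdSimplex (sum_part_ne_zero hm)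

theorem map_fiberSum_dirichlet_part (hm : weight m ≠ 0) {l : ℕ} (f : Fin (numParts m) → Fin l) :
    (dirichlet fun t : Fin (numParts m) => (part m t : ℝ)).map (fiberSum f) =
      dirichlet fun i => ((fiberSum f (fun t => part m t) i : ℕ) : ℝ) := by
  simpa [fiberSum] using map_fiberSum_dirichlet f (sum_part_ne_zero hm)

end DirichletPart

section RandomMeasure

variable {Ω Θ : Type*} [MeasurableSpace Ω] {k : ℕ} {M : Θ → Fin k → ℕ} {X : ℕ → Θ → Ω}
  {W : ℕ → Θ → ℝ}

theorem measurable_randomMeasure [MeasurableSpace Θ] (hM : Measurable M)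
    (hX : ∀ t, Measurable (X t)) (hW : ∀ t, Measurable (W t)) :
    Measurable (randomMeasure M X W) := by
  refine Measure.measurable_of_measurable_coe _ fun s hs => ?_
  have hterms : Measurable fun p : (Fin k → ℕ) × Θ =>
      ∑ t ∈ Finset.range (numParts p.1), ENNReal.ofReal (W t p.2) * s.indicator 1 (X t p.2) :=
    measurable_from_prod_countable_right fun m =>
      Finset.measurable_sum (Finset.range (numParts m)) fun t _ =>
        (hW t).ennreal_ofReal.mul ((measurable_one.indicator hs).comp (hX t))
  simpa [randomMeasure, Measure.finsetSum_apply, Measure.dirac_apply' _ hs, Function.comp_def]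
    using hterms.comp (hM.prodMk measurable_id)

theorem isProbabilityMeasure_randomMeasure {θ : Θ}
    (hW : (fun t : Fin (numParts (M θ)) => W t θ) ∈ stdSimplex ℝ (Fin (numParts (M θ)))) :
    IsProbabilityMeasure (randomMeasure M X W θ) := by
  constructor
  simp only [randomMeasure, Measure.finsetSum_apply, Measure.smul_apply, measure_univ, smul_eq_mul,
    mul_one, Finset.sum_range]
  rw [← ENNReal.ofReal_sum_of_nonneg fun t _ => hW.1 t, hW.2, ENNReal.ofReal_one]

theorem real_randomMeasure_preimage {κ : Type*} [DecidableEq κ] [MeasurableSpace κ]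
    [MeasurableSingletonClass κ] {c : Ω → κ} (hc : Measurable c) {θ : Θ}
    (hW : ∀ t : Fin (numParts (M θ)), 0 ≤ W t θ) (i : κ) :
    (randomMeasure M X W θ).real (c ⁻¹' {i}) =
      fiberSum (c ∘ fun t : Fin (numParts (M θ)) => X t θ) (fun t => W t θ) i := by
  have hi : MeasurableSet (c ⁻¹' {i}) := hc (measurableSet_singleton i)
  have hterm (t : Fin (numParts (M θ))) (_ : t ∈ Finset.univ) :
      (ENNReal.ofReal (W t θ) • Measure.dirac (X t θ)) (c ⁻¹' {i}) ≠ ∞ :=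
    ENNReal.mul_ne_top ENNReal.ofReal_ne_top (measure_ne_top _ _)
  rw [randomMeasure, Finset.sum_range, measureReal_def, Measure.finsetSum_apply,
    ENNReal.toReal_sum hterm, fiberSum, Finset.sum_filter]
  refine Finset.sum_congr rfl fun t _ => ?_
  by_cases h : c (X t θ) = i <;> simp [Measure.dirac_apply' _ hi, h, hW t]

end RandomMeasure

theorem inv_smul_apply_eq_ofReal {Ω : Type*} [MeasurableSpace Ω] (α : Measure Ω)
    [IsFiniteMeasure α] [NeZero α] (s : Set Ω) :
    ((α Set.univ)⁻¹ • α) s = ENNReal.ofReal (α.real s / α.real Set.univ) := by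
  rw [ENNReal.ofReal_div_of_pos measureReal_univ_pos, ofReal_measureReal, ofReal_measureReal,
    Measure.smul_apply, smul_eq_mul, ENNReal.div_eq_inv_mul]

section Selection

variable {Ω Θ : Type*} [MeasurableSpace Ω] [MeasurableSpace Θ] {k : ℕ} {α : Measure Ω}
  {μ : Measure Θ} {M : Θ → Fin k → ℕ} {X : ℕ → Θ → Ω} {W : ℕ → Θ → ℝ} {m : Fin k → ℕ}

theorem ae_mem_ofWeight {a : ℝ} (hM : HasLaw M (ewens k a) μ) : ∀ᵐ θ ∂μ, M θ ∈ ofWeight k k :=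
  ae_of_ae_map hM.aemeasurable (hM.map_eq ▸ ae_ewens_mem_ofWeight k a)

theorem mem_ofWeight_of_measure_preimage_ne_zero {a : ℝ} (hM : HasLaw M (ewens k a) μ)
    (hm : μ (M ⁻¹' {m}) ≠ 0) : m ∈ ofWeight k k := by
  by_contra hmem
  refine hm (measure_mono_null ?_ (ae_iff.1 (ae_mem_ofWeight hM)))
  rintro θ rfl
  exact hmem

namespace IsEwensSelection

theorem measure_preimage_singleton (h : IsEwensSelection k α μ M X W) (hm : m ∈ ofWeight k k) :
    μ (M ⁻¹' {m}) =
      ENNReal.ofReal (ewensCoeff m * α.real Set.univ ^ (∑ j, m j) / poch (α.real Set.univ) k) := by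
  rw [← Measure.map_apply h.measurable_M (measurableSet_singleton m), h.law_M.map_eq,
    ewens_singleton _ hm]

theorem weight_ne_zero (h : IsEwensSelection k α μ M X W) (hk : 0 < k)
    (hm : μ (M ⁻¹' {m}) ≠ 0) : weight m ≠ 0 := by
  rw [mem_ofWeight.1 (mem_ofWeight_of_measure_preimage_ne_zero h.law_M hm)]
  exact hk.ne'

theorem ae_mem_stdSimplex (h : IsEwensSelection k α μ M X W) (hk : 0 < k)
    (hm : μ (M ⁻¹' {m}) ≠ 0) :
    ∀ᵐ θ ∂cond μ (M ⁻¹' {m}), (fun t : Fin (numParts (M θ)) => W t θ) ∈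
      stdSimplex ℝ (Fin (numParts (M θ))) := by
  have hW := ae_of_ae_map (h.law_W m hm).aemeasurable
    ((h.law_W m hm).map_eq ▸ ae_dirichlet_part_mem_stdSimplex (h.weight_ne_zero hk hm))
  filter_upwards [ae_cond_mem (h.measurable_M (measurableSet_singleton m)), hW] with θ hθ hWθ
  obtain rfl : M θ = m := hθ
  exact hWθ

theorem hasLaw_cond_prodMk (h : IsEwensSelection k α μ M X W) (hm : μ (M ⁻¹' {m}) ≠ 0) :
    HasLaw (fun θ => (fun t : Fin (numParts m) => X t θ, fun t : Fin (numParts m) => W t θ))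
      ((Measure.pi fun _ => (α Set.univ)⁻¹ • α).prod
        (dirichlet fun t : Fin (numParts m) => (part m t : ℝ)))
      (cond μ (M ⁻¹' {m})) :=
  (indepFun_iff_hasLaw_prodMk_prod
    (iIndepFun.hasLaw_pi (X := fun t : Fin (numParts m) => X t) (fun t => h.law_X m hm t t.2)
      (h.indep_X m hm)) (h.law_W m hm)).1
    (h.indep_X_W m hm)

theorem map_masses_cond [IsFiniteMeasure α] [NeZero α] (h : IsEwensSelection k α μ M X W)
    (hk : 0 < k) (hm : μ (M ⁻¹' {m}) ≠ 0) {l : ℕ} {c : Ω → Fin l} (hc : Measurable c) :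
    (cond μ (M ⁻¹' {m})).map (fun θ i => (randomMeasure M X W θ).real (c ⁻¹' {i})) =
      ∑ f : Fin (numParts m) → Fin l,
        (∏ t, ENNReal.ofReal (α.real (c ⁻¹' {f t}) / α.real Set.univ)) •
          dirichlet fun i => ((fiberSum f (fun t => part m t) i : ℕ) : ℝ) := by
  have hw := h.weight_ne_zero hk hm
  have := isProbabilityMeasure_dirichlet_part hw
  have hXW := h.hasLaw_cond_prodMk hm
  have hg : Measurable fun p : (Fin (numParts m) → Ω) × (Fin (numParts m) → ℝ) =>
      fiberSum (c ∘ p.1) p.2 := by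
    refine measurable_uncurry_fiberSum.comp (Measurable.prodMk ?_ measurable_snd)
    exact measurable_pi_lambda _ fun t => by fun_prop
  have hmasses : (fun θ i => (randomMeasure M X W θ).real (c ⁻¹' {i})) =ᵐ[cond μ (M ⁻¹' {m})]
      fun θ => fiberSum (c ∘ fun t : Fin (numParts m) => X t θ) fun t => W t θ := by
    filter_upwards [ae_cond_mem (h.measurable_M (measurableSet_singleton m)),
      h.ae_mem_stdSimplex hk hm] with θ hθ hWθ
    obtain rfl : M θ = m := hθ
    exact funext (real_randomMeasure_preimage hc hWθ.1)
  calc (cond μ (M ⁻¹' {m})).map (fun θ i => (randomMeasure M X W θ).real (c ⁻¹' {i}))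
      = ((Measure.pi fun _ => (α Set.univ)⁻¹ • α).prod
          (dirichlet fun t : Fin (numParts m) => (part m t : ℝ))).map
            fun p => fiberSum (c ∘ p.1) p.2 := by
        rw [Measure.map_congr hmasses, ← hXW.map_eq,
          AEMeasurable.map_map_of_aemeasurable hg.aemeasurable hXW.aemeasurable]
        rfl
    _ = _ := by
        rw [map_fiberSum_coloring hc]
        simp_rw [inv_smul_apply_eq_ofReal, map_fiberSum_dirichlet_part hw]

theorem ae_isProbabilityMeasure_randomMeasure [IsFiniteMeasure μ]
    (h : IsEwensSelection k α μ M X W) (hk : 0 < k) :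
    ∀ᵐ θ ∂μ, IsProbabilityMeasure (randomMeasure M X W θ) := by
  rw [← sum_measure_smul_cond h.measurable_M (ae_mem_ofWeight h.law_M), ae_finsetSum_measure_iff]
  intro m _
  obtain hm | hm := eq_or_ne (μ (M ⁻¹' {m})) 0
  · simp [hm]
  · exact Measure.ae_smul_measure ((h.ae_mem_stdSimplex hk hm).mono fun _ =>
      isProbabilityMeasure_randomMeasure) _

theorem isQuasiBernoulliProcess_randomMeasure [IsFiniteMeasure α] [NeZero α] [IsFiniteMeasure μ]
    (h : IsEwensSelection k α μ M X W) (hk : 0 < k) :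
    IsQuasiBernoulliProcess k α μ (randomMeasure M X W) where
  measurable := measurable_randomMeasure h.measurable_M h.measurable_X h.measurable_W
  isProbabilityMeasure := h.ae_isProbabilityMeasure_randomMeasure hk
  law d A hA hdisj hcover := by
    have hP := measurable_randomMeasure h.measurable_M h.measurable_X h.measurable_W
    have hmasses : Measurable fun θ i => (randomMeasure M X W θ).real (A i) :=
      measurable_pi_lambda _ fun i => ((Measure.measurable_coe (hA i)).comp hP).ennreal_toReal
    have htotal : ∑ i, α.real (A i) = α.real Set.univ := by
      rw [← hcover, measureReal_iUnion_fintype hdisj hA]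
    obtain ⟨c, hc, hAc⟩ := exists_measurable_coloring hA hdisj hcover
    refine ⟨hmasses.aemeasurable, ?_⟩
    rw [quasiBernoulli, ← sum_ewens_smul_sum_coloring (fun _ => measureReal_nonneg)
      (htotal ▸ measureReal_univ_pos) fun b => dirichlet fun i => (b i : ℝ)]
    conv_lhs => rw [← sum_measure_smul_cond h.measurable_M (ae_mem_ofWeight h.law_M)]
    rw [Measure.map_finset_sum hmasses.aemeasurable]
    refine Finset.sum_congr rfl fun m hmem => ?_
    rw [Measure.map_smul, htotal, ← h.measure_preimage_singleton hmem]
    obtain hm | hm := eq_or_ne (μ (M ⁻¹' {m})) 0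
    · rw [hm, zero_smul, zero_smul]
    · simp_rw [hAc, h.map_masses_cond hk hm hc]

end IsEwensSelection

end Selection

section ProductSpace

variable {E F G : Type*} [MeasurableSpace E] [MeasurableSpace F] [MeasurableSpace G]

theorem cond_prod_fst_preimage_singleton [MeasurableSingletonClass E] (ν : Measure E)
    [IsFiniteMeasure ν] (π : Measure F) [IsProbabilityMeasure π] {m : E} (hm : ν {m} ≠ 0) :
    cond (ν.prod π) (Prod.fst ⁻¹' {m}) = π.map (Prod.mk m) := by
  rw [ProbabilityTheory.cond, ← Set.prod_univ, ← Measure.prod_restrict, Measure.restrict_singleton,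
    Measure.restrict_univ, Measure.prod_smul_left, Measure.dirac_prod, smul_smul, Measure.prod_prod,
    measure_univ, mul_one, ENNReal.inv_mul_cancel hm (measure_ne_top ν _), one_smul]

theorem measurePreserving_infinitePi_comp {ι κ : Type*} [Fintype κ] (ρ : Measure E)
    [IsProbabilityMeasure ρ] {g : κ → ι} (hg : Function.Injective g) :
    MeasurePreserving (fun (x : ι → E) i => x (g i)) (Measure.infinitePi fun _ => ρ)
      (Measure.pi fun _ => ρ) where
  measurable := by fun_prop
  map_eq := by rw [Measure.map_infinitePi_infinitePi_of_inj hg, Measure.infinitePi_eq_pi]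

end ProductSpace

section Existence

variable {Ω : Type u} [MeasurableSpace Ω] {k : ℕ} {α : Measure Ω} [IsFiniteMeasure α] [NeZero α]

theorem isEwensSelection_of_hasLaw_cond {Θ : Type*} [MeasurableSpace Θ] {μ : Measure Θ}
    [IsFiniteMeasure μ] {M : Θ → Fin k → ℕ} {X : ℕ → Θ → Ω} {W : ℕ → Θ → ℝ} (hk : 0 < k)
    (hM : Measurable M) (hX : ∀ t, Measurable (X t)) (hW : ∀ t, Measurable (W t))
    (hMlaw : HasLaw M (ewens k (α.real Set.univ)) μ)
    (hXW : ∀ m, μ (M ⁻¹' {m}) ≠ 0 →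
      HasLaw (fun θ => (fun t : Fin (numParts m) => X t θ, fun t : Fin (numParts m) => W t θ))
        ((Measure.pi fun _ => (α Set.univ)⁻¹ • α).prod
          (dirichlet fun t : Fin (numParts m) => (part m t : ℝ)))
        (cond μ (M ⁻¹' {m}))) :
    IsEwensSelection k α μ M X W := by
  have hdirichlet (m) (hm : μ (M ⁻¹' {m}) ≠ 0) :
      IsProbabilityMeasure (dirichlet fun t : Fin (numParts m) => (part m t : ℝ)) :=
    isProbabilityMeasure_dirichlet_part <|
      (mem_ofWeight.1 (mem_ofWeight_of_measure_preimage_ne_zero hMlaw hm)).trans_ne hk.ne'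
  have hXlaw (m) (hm : μ (M ⁻¹' {m}) ≠ 0) :
      HasLaw (fun θ (t : Fin (numParts m)) => X t θ)
        (Measure.pi fun _ => (α Set.univ)⁻¹ • α) (cond μ (M ⁻¹' {m})) :=
    have := hdirichlet m hm
    measurePreserving_fst.hasLaw.comp (hXW m hm)
  have hXtlaw (m) (hm : μ (M ⁻¹' {m}) ≠ 0) (t : Fin (numParts m)) :
      HasLaw (X t) ((α Set.univ)⁻¹ • α) (cond μ (M ⁻¹' {m})) :=
    (measurePreserving_eval _ t).hasLaw.comp (hXlaw m hm)
  have hWlaw (m) (hm : μ (M ⁻¹' {m}) ≠ 0) :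
      HasLaw (fun θ (t : Fin (numParts m)) => W t θ)
        (dirichlet fun t : Fin (numParts m) => (part m t : ℝ)) (cond μ (M ⁻¹' {m})) :=
    have := hdirichlet m hm
    measurePreserving_snd.hasLaw.comp (hXW m hm)
  exact
    { measurable_M := hM
      measurable_X := hX
      measurable_W := hW
      law_M := hMlaw
      law_X := fun m hm t ht => hXtlaw m hm ⟨t, ht⟩
      indep_X := fun m hm =>
        have := cond_isProbabilityMeasure hm
        (iIndepFun_iff_hasLaw_pi_pi (hXtlaw m hm)).2 (hXlaw m hm)
      law_W := hWlaw
      indep_X_W := fun m hm =>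
        (indepFun_iff_hasLaw_prodMk_prod (hXlaw m hm) (hWlaw m hm)).2 (hXW m hm) }

/-- Families with one vector of weights for each partition `m` of `k`; `W` is sampled by drawing
such a family and keeping its `M`-th member. -/
abbrev WeightFamily (k : ℕ) : Type := (m : ofWeight k k) → Fin (numParts m.1) → ℝ

/-- The coordinate `t` of the `m`-th member of a family of weight vectors, extended by `0` to all
indices `m` and `t`. -/
def selectedWeight (t : ℕ) (q : (Fin k → ℕ) × WeightFamily k) : ℝ :=
  if h : q.1 ∈ ofWeight k k ∧ t < numParts q.1 then q.2 ⟨q.1, h.1⟩ ⟨t, h.2⟩ else 0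

theorem selectedWeight_mk {m : Fin k → ℕ} (hm : m ∈ ofWeight k k) (t : Fin (numParts m))
    (y : WeightFamily k) : selectedWeight t (m, y) = y ⟨m, hm⟩ t :=
  dif_pos ⟨hm, t.2⟩

theorem measurable_selectedWeight (t : ℕ) :
    Measurable (selectedWeight t : (Fin k → ℕ) × WeightFamily k → ℝ) := by
  refine measurable_from_prod_countable_right fun m => ?_
  by_cases h : m ∈ ofWeight k k ∧ t < numParts m
  · simp only [selectedWeight, dif_pos h]
    have hmember : Measurable fun y : WeightFamily k => y ⟨m, h.1⟩ := measurable_pi_apply _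
    exact measurable_pi_iff.1 hmember ⟨t, h.2⟩
  · simp only [selectedWeight, dif_neg h, measurable_const]

variable (α) in
theorem exists_isEwensSelection (hk : 0 < k) :
    ∃ (Θ : Type u) (_ : MeasurableSpace Θ) (μ : Measure Θ)
      (M : Θ → Fin k → ℕ) (X : ℕ → Θ → Ω) (W : ℕ → Θ → ℝ),
      IsProbabilityMeasure μ ∧ IsEwensSelection k α μ M X W := by
  let D (m : ofWeight k k) : Measure (Fin (numParts m.1) → ℝ) :=
    dirichlet fun t : Fin (numParts m.1) => (part m.1 t : ℝ)
  have hD (m : ofWeight k k) : IsProbabilityMeasure (D m) :=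
    isProbabilityMeasure_dirichlet_part ((mem_ofWeight.1 m.2).trans_ne hk.ne')
  have hewens := isProbabilityMeasure_ewens (k := k) (measureReal_univ_pos (μ := α))
  let ν : Measure ((ℕ → Ω) × WeightFamily k) :=
    (Measure.infinitePi fun _ => (α Set.univ)⁻¹ • α).prod (Measure.pi D)
  have hM : HasLaw Prod.fst (ewens k (α.real Set.univ)) ((ewens k (α.real Set.univ)).prod ν) :=
    measurePreserving_fst.hasLaw
  have hX (t : ℕ) : Measurable fun θ : (Fin k → ℕ) × (ℕ → Ω) × WeightFamily k => θ.2.1 t := by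
    fun_prop
  have hW (t : ℕ) : Measurable fun θ : (Fin k → ℕ) × (ℕ → Ω) × WeightFamily k =>
      selectedWeight t (θ.1, θ.2.2) :=
    (measurable_selectedWeight t).comp (by fun_prop)
  refine ⟨_, inferInstance, _, _, _, _, inferInstance,
    isEwensSelection_of_hasLaw_cond hk measurable_fst hX hW hM fun m hm => ?_⟩
  have hmem := mem_ofWeight_of_measure_preimage_ne_zero hM hm
  rw [← Measure.map_apply measurable_fst (measurableSet_singleton m), hM.map_eq] at hm
  have hν : MeasurePreserving (Prod.map (fun x (t : Fin (numParts m)) => x t)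
      (Function.eval ⟨m, hmem⟩)) ν ((Measure.pi fun _ => (α Set.univ)⁻¹ • α).prod (D ⟨m, hmem⟩)) :=
    (measurePreserving_infinitePi_comp _ Fin.val_injective).prod (measurePreserving_eval D _)
  have hXW := (measurable_pi_lambda _ fun t : Fin (numParts m) => hX t).prodMk
    (measurable_pi_lambda _ fun t : Fin (numParts m) => hW t)
  refine ⟨hXW.aemeasurable, ?_⟩
  rw [cond_prod_fst_preimage_singleton _ _ hm, Measure.map_map hXW measurable_prodMk_left,
    ← hν.map_eq]
  congr 1
  exact funext fun p => Prod.ext rfl (funext fun t => selectedWeight_mk hmem t p.2)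

end Existence

end QuasiBernoulli

theorem theorem5p1 {Ω : Type u} [MeasurableSpace Ω] (α : MeasureTheory.Measure Ω)
    [MeasureTheory.IsFiniteMeasure α] (hα : α ≠ 0) (k : ℕ) (hk : 0 < k) :
    (∃ (Θ : Type u) (_ : MeasurableSpace Θ) (μ : MeasureTheory.Measure Θ)
      (M : Θ → Fin k → ℕ) (X : ℕ → Θ → Ω) (W : ℕ → Θ → ℝ),
      MeasureTheory.IsProbabilityMeasure μ ∧ QuasiBernoulli.IsEwensSelection k α μ M X W) ∧
    (∀ (Θ : Type v) [MeasurableSpace Θ] (μ : MeasureTheory.Measure Θ)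
      [MeasureTheory.IsProbabilityMeasure μ]
      (M : Θ → Fin k → ℕ) (X : ℕ → Θ → Ω) (W : ℕ → Θ → ℝ),
      QuasiBernoulli.IsEwensSelection k α μ M X W →
      QuasiBernoulli.IsQuasiBernoulliProcess k α μ (QuasiBernoulli.randomMeasure M X W)) := by
  have : NeZero α := ⟨hα⟩
  exact ⟨QuasiBernoulli.exists_isEwensSelection α hk,
    fun _ _ _ _ _ _ _ h => h.isQuasiBernoulliProcess_randomMeasure hk⟩
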